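/- **Setting.** Let $\Sigma$ be a connected, paracompact Hausdorff real-analytic manifold of dimension $d$, and let $G$ be a (finite-dimensional) compact connected Lie group. *Paths.* An analytic arc on $[a,b]$ ($a<b$) is a map $[a,b]\to\Sigma$ that is analytic on the closed interval, has non-vanishing velocity there, and embeds the open interval $]a,b[$ (its two end points may coincide). A curve is a continuous map $c:[0,1]\to\Sigma$ with a subdivision $0=t_0<\dots<t_n=1$ such that on each $[t_k,t_{k+1}]$ it is an analytic arc or constant; its source is $s(c)=c(0)$, its range $r(c)=c(1)$. The curve $c_2c_1$ (for $s(c_2)=r(c_1)$) runs through $c_1$ and then through $c_2$, each at double speed, and $c^{-1}(t)=c(1-t)$. Let $\mathcal P$ be the groupoid with set of objects $\Sigma$ whose arrows are the curves modulo the smallest equivalence relation, between curves with the same source and the same range, that is compatible with composition, identifies $c$ with $c\circ\varphi$ for every orientation preserving piecewise analytic diffeomorphism $\varphi$ of $[0,1]$, and identifies $c$ with $c\,(a^{-1}a)$ and with $(a^{-1}a)\,c$ for all curves $a$ for which these are defined (insertion of retracings). An edge is the class $e=[c]$ of an analytic arc $c:[0,1]\to\Sigma$, with $\sigma(e)=c([0,1])$.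 A finite set of edges $\{e_1,\dots,e_n\}$ is independent if, for suitable representing arcs, $\sigma(e_i)\cap\sigma(e_j)\subset\{s(e_i),r(e_i)\}$ for all $i\ne j$. Let $\mathcal L$ be the set of subgroupoids of $\mathcal P$ generated by finite independent sets of edges, partially ordered by inclusion. *Connections.* For $L\in\mathcal L$ let $\mathcal A_L=\mathrm{Hom}[L,G]$ and let $\bar{\mathcal A}=\mathrm{Hom}[\mathcal P,G]$ be the sets of functors to $G$, i.e. of maps $A$ with $A(p'p)=A(p')A(p)$ and $A(p^{-1})=A(p)^{-1}$, each with the weakest topology making all evaluations $A\mapsto A(p)$ continuous; on $\mathcal A_L$ this is the topology induced from $G^n$ by $A\mapsto(A(e_1),\dots,A(e_n))$, for any independent generators $e_1,\dots,e_n$ of $L$. Let $p_L:\bar{\mathcal A}\to\mathcal A_L$ and, for $L\le L'$, $p_{L,L'}:\mathcal A_{L'}\to\mathcal A_L$ be the restriction maps. A family $\{\mu_L\}_{L\in\mathcal L}$ of regular Borel probability measures $\mu_L$ on $\mathcal A_L$ is consistent if $\mu_L=(p_{L,L'})_*\mu_{L'}$ whenever $L\le L'$. **Proposition.** The map $\mu\mapsto\{(p_L)_*\mu\}_{L\in\mathcal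 L}$ is a bijection from the set of regular Borel probability measures on $\bar{\mathcal A}$ onto the set of consistent families. Explicitly, for every consistent family $\{\mu_L\}$ there is a unique regular Borel probability measure $\mu$ on $\bar{\mathcal A}$ such that $$\int_{\mathcal A_L} f\,d\mu_L=\int_{\bar{\mathcal A}} f\circ p_L\,d\mu\qquad\text{for all } L\in\mathcal L \text{ and all continuous } f:\mathcal A_L\to\mathbb C .$$ -/

import Mathlib

open scoped Manifold ContDiff
open CategoryTheory MeasureTheory Set

noncomputable section

/-! ## Piecewise conditions -/

/-- `PiecewiseOn P a b`: there is a subdivision `a = t₀ < t₁ < ⋯ < tₙ = b` with `n ≥ 1` such that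
`P tₖ tₖ₊₁` holds for all `k` (expressed as a transitive closure). -/
def PiecewiseOn (P : ℝ → ℝ → Prop) (a b : ℝ) : Prop :=
  Relation.TransGen (fun s t => s < t ∧ P s t) a b

theorem PiecewiseOn.single {P : ℝ → ℝ → Prop} {a b : ℝ} (hab : a < b) (h : P a b) :
    PiecewiseOn P a b :=
  Relation.TransGen.single ⟨hab, h⟩

theorem PiecewiseOn.trans {P : ℝ → ℝ → Prop} {a b c : ℝ} (h : PiecewiseOn P a b)
    (h' : PiecewiseOn P b c) : PiecewiseOn P a c :=
  Relation.TransGen.trans h h'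

theorem PiecewiseOn.lt {P : ℝ → ℝ → Prop} {a b : ℝ} (h : PiecewiseOn P a b) : a < b := by
  induction h with
  | single h => exact h.1
  | tail _ h ih => exact ih.trans h.1

theorem PiecewiseOn.affine {P Q : ℝ → ℝ → Prop} {a b : ℝ} (k l : ℝ) (hk : 0 < k)
    (h : PiecewiseOn P a b)
    (hPQ : ∀ s t, a ≤ s → s < t → t ≤ b → P s t → Q (k * s + l) (k * t + l)) :
    PiecewiseOn Q (k * a + l) (k * b + l) := by
  induction h with
  | single h =>
    exact PiecewiseOn.single (by nlinarith [h.1]) (hPQ _ _ le_rfl h.1 le_rfl h.2)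
  | tail h₁ h ih =>
    have h₁' := PiecewiseOn.lt h₁
    refine PiecewiseOn.trans (ih fun s t hs hst ht => hPQ s t hs hst (ht.trans h.1.le)) ?_
    exact PiecewiseOn.single (by nlinarith [h.1]) (hPQ _ _ h₁'.le h.1 le_rfl h.2)

theorem PiecewiseOn.reverse {P Q : ℝ → ℝ → Prop} {a b : ℝ} (h : PiecewiseOn P a b)
    (hPQ : ∀ s t, s < t → P s t → Q (1 - t) (1 - s)) : PiecewiseOn Q (1 - b) (1 - a) := by
  induction h with
  | single h => exact PiecewiseOn.single (by linarith [h.1]) (hPQ _ _ h.1 h.2)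
  | tail _ h ih =>
    exact PiecewiseOn.trans (PiecewiseOn.single (by linarith [h.1]) (hPQ _ _ h.1 h.2)) ih

/-! ## Piecewise analytic curves -/

section Curves

variable (d : ℕ) {M : Type*} [TopologicalSpace M] [ChartedSpace (EuclideanSpace ℝ (Fin d)) M]

/-- `f` restricts on `[a, b]` to a regularly parametrized analytic arc: it is analytic on the closed
interval (up to and including the end points) with nowhere vanishing velocity there, and it embeds
the open interval `]a, b[` in `M`. The two end points may have the same image. -/
structure IsAnalyticArc (f : ℝ → M) (a b : ℝ) : Prop where
  analytic : ContMDiffOn 𝓘(ℝ, ℝ) (𝓡 d) ω f (Icc a b)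
  immersion : ∀ t ∈ Icc a b, mfderivWithin 𝓘(ℝ, ℝ) (𝓡 d) f (Icc a b) t ≠ 0
  embedding : Topology.IsEmbedding (fun t : Ioo a b => f t)

/-- The pieces of a curve: the image of the open interval is an embedded submanifold, either of
dimension one (an analytic arc) or of dimension zero (a constant piece). -/
def IsPiece (f : ℝ → M) (a b : ℝ) : Prop :=
  IsAnalyticArc d f a b ∨ ∃ x, ∀ t ∈ Icc a b, f t = x

/-- Continuous, oriented, piecewise analytic parametrized curves `c : [0, 1] → M`
with `s(c) = x` and `r(c) = y`. -/
@[ext]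
structure Curve (x y : M) where
  path : Path x y
  piecewise : PiecewiseOn (IsPiece d path.extend) 0 1

/-- Orientation preserving piecewise analytic diffeomorphisms of `[0, 1]` (the values outside
`[0, 1]` are irrelevant): on the closed intervals of some subdivision, `φ` is analytic with
positive derivative. Such a `φ` is automatically an increasing homeomorphism of `[0, 1]`. -/
structure IsReparametrization (φ : ℝ → ℝ) : Prop where
  map_zero : φ 0 = 0
  map_one : φ 1 = 1
  piecewise : PiecewiseOn
    (fun a b => AnalyticOn ℝ φ (Icc a b) ∧ ∀ t ∈ Icc a b, 0 < derivWithin φ (Icc a b) t) 0 1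

variable {d}

theorem IsAnalyticArc.comp_affine {f g : ℝ → M} {a b a' b' : ℝ} (h : IsAnalyticArc d f a b)
    (k l : ℝ) (hk : k ≠ 0) (hab' : a' < b') (hI : ∀ t ∈ Icc a' b', k * t + l ∈ Icc a b)
    (hO : ∀ t ∈ Ioo a' b', k * t + l ∈ Ioo a b)
    (hg : ∀ t ∈ Icc a' b', g t = f (k * t + l)) : IsAnalyticArc d g a' b' := by
  have hφs : ContDiff ℝ ω (fun t : ℝ => k * t + l) := by fun_prop
  have hφ : ContMDiff 𝓘(ℝ, ℝ) 𝓘(ℝ, ℝ) ω (fun t : ℝ => k * t + l) := hφs.contMDiff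
  refine ⟨?_, ?_, ?_⟩
  · exact (h.analytic.comp hφ.contMDiffOn hI).congr hg
  · intro t ht h0
    have hu : UniqueMDiffWithinAt 𝓘(ℝ, ℝ) (Icc a' b') t :=
      (uniqueDiffOn_Icc hab' t ht).uniqueMDiffWithinAt
    have hf : MDifferentiableWithinAt 𝓘(ℝ, ℝ) (𝓡 d) f (Icc a b) (k * t + l) :=
      (h.analytic _ (hI t ht)).mdifferentiableWithinAt (by simp)
    have hφd : HasDerivWithinAt (fun t : ℝ => k * t + l) k (Icc a' b') t := by
      simpa using (((hasDerivAt_id t).const_mul k).add_const l).hasDerivWithinAt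
    have hφm : HasMFDerivWithinAt 𝓘(ℝ, ℝ) 𝓘(ℝ, ℝ) (fun t : ℝ => k * t + l) (Icc a' b') t
        (ContinuousLinearMap.toSpanSingleton ℝ k) :=
      hφd.hasFDerivWithinAt.hasMFDerivWithinAt
    have hcomp := (HasMFDerivWithinAt.comp (x := t) (g := f)
      (f := fun t : ℝ => k * t + l) hf.hasMFDerivWithinAt hφm hI)
    have hg' := (HasMFDerivWithinAt.congr_of_eventuallyEq hcomp
      (Filter.eventually_of_mem self_mem_nhdsWithin hg) (hg t ht)).mfderivWithin hu
    refine h.immersion _ (hI t ht) ?_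
    ext1
    have h1 : (mfderivWithin 𝓘(ℝ, ℝ) (𝓡 d) f (Icc a b) (k * t + l))
        ((k⁻¹ : ℝ) • (k : ℝ) : ℝ) = 0 :=
      DFunLike.congr_fun (hg'.symm.trans h0) (k⁻¹ : ℝ)
    have h2 : ((k⁻¹ : ℝ) • (k : ℝ) : ℝ) = 1 := by rw [smul_eq_mul, inv_mul_cancel₀ hk]
    rw [h2] at h1
    exact h1
  · have hi : Topology.IsEmbedding (fun t : ℝ => k * t + l) :=
      ((Homeomorph.mulLeft₀ k hk).trans (Homeomorph.addRight l)).isEmbedding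
    have hj : Topology.IsEmbedding (fun t : Ioo a' b' => (⟨k * t + l, hO t t.2⟩ : Ioo a b)) :=
      (hi.comp Topology.IsEmbedding.subtypeVal).codRestrict _ _
    have := h.embedding.comp hj
    convert this using 1
    ext t
    exact hg t (Ioo_subset_Icc_self t.2)

theorem IsPiece.comp_affine {f g : ℝ → M} {a b a' b' : ℝ} (h : IsPiece d f a b)
    (k l : ℝ) (hk : k ≠ 0) (hab' : a' < b') (hI : ∀ t ∈ Icc a' b', k * t + l ∈ Icc a b)
    (hO : ∀ t ∈ Ioo a' b', k * t + l ∈ Ioo a b)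
    (hg : ∀ t ∈ Icc a' b', g t = f (k * t + l)) : IsPiece d g a' b' := by
  rcases h with h | ⟨x, hx⟩
  · exact Or.inl (h.comp_affine k l hk hab' hI hO hg)
  · exact Or.inr ⟨x, fun t ht => by rw [hg t ht, hx _ (hI t ht)]⟩

namespace Curve

/-- The constant curve. -/
def refl (x : M) : Curve d x x where
  path := Path.refl x
  piecewise := PiecewiseOn.single zero_lt_one (Or.inr ⟨x, fun _ _ => rfl⟩)

/-- The reversed curve `t ↦ c(1 - t)`. -/
def symm {x y : M} (c : Curve d x y) : Curve d y x where
  path := c.path.symm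
  piecewise := by
    have := PiecewiseOn.reverse (Q := IsPiece d c.path.symm.extend) c.piecewise
      (fun s t hst h => h.comp_affine (-1) 1 (by norm_num) (by linarith)
        (fun u hu => ⟨by linarith [hu.2], by linarith [hu.1]⟩)
        (fun u hu => ⟨by linarith [hu.2], by linarith [hu.1]⟩)
        (fun u _ => by rw [Path.extend_symm_apply]; congr 1; ring))
    simpa using this

/-- The composition: first `c₁`, at double speed, and then `c₂`, at double speed. -/
def trans {x y z : M} (c₁ : Curve d x y) (c₂ : Curve d y z) : Curve d x z where
  path := c₁.path.trans c₂.path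
  piecewise := by
    have h₁ := PiecewiseOn.affine (Q := IsPiece d (c₁.path.trans c₂.path).extend) (1 / 2) 0
      (by norm_num) c₁.piecewise
      (fun s t _ hst ht h => h.comp_affine 2 0 (by norm_num) (by linarith)
        (fun u hu => ⟨by linarith [hu.1], by linarith [hu.2]⟩)
        (fun u hu => ⟨by linarith [hu.1], by linarith [hu.2]⟩)
        (fun u hu => by
          rw [Path.extend_trans_of_le_half _ _ (by linarith [hu.2])]; congr 1; ring))
    have h₂ := PiecewiseOn.affine (Q := IsPiece d (c₁.path.trans c₂.path).extend) (1 / 2) (1 / 2)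
      (by norm_num) c₂.piecewise
      (fun s t hs hst _ h => h.comp_affine 2 (-1) (by norm_num) (by linarith)
        (fun u hu => ⟨by linarith [hu.1], by linarith [hu.2]⟩)
        (fun u hu => ⟨by linarith [hu.1], by linarith [hu.2]⟩)
        (fun u hu => by
          rw [Path.extend_trans_of_half_le _ _ (by linarith [hu.1])]; congr 1))
    norm_num at h₁ h₂
    exact h₁.trans h₂

end Curve

/-- Equality of curves up to a reparametrization and a finite number of retracings: the smallest
equivalence relation on curves with common end points that is compatible with composition,
identifies a curve with its reparametrizations, and allows to insert a retracing `a a⁻¹`. -/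
inductive CurveEquiv : ∀ {x y : M}, Curve d x y → Curve d x y → Prop
  | refl {x y : M} (c : Curve d x y) : CurveEquiv c c
  | symm {x y : M} {c c' : Curve d x y} : CurveEquiv c c' → CurveEquiv c' c
  | trans {x y : M} {c c' c'' : Curve d x y} :
      CurveEquiv c c' → CurveEquiv c' c'' → CurveEquiv c c''
  | comp {x y z : M} {c₁ c₁' : Curve d x y} {c₂ c₂' : Curve d y z} :
      CurveEquiv c₁ c₁' → CurveEquiv c₂ c₂' → CurveEquiv (c₁.trans c₂) (c₁'.trans c₂')
  | reparam {x y : M} {c c' : Curve d x y} (φ : ℝ → ℝ) (hφ : IsReparametrization φ)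
      (h : ∀ t ∈ Icc (0 : ℝ) 1, c'.path.extend t = c.path.extend (φ t)) : CurveEquiv c c'
  | retrace_start {x y z : M} (a : Curve d x z) (c : Curve d x y) :
      CurveEquiv ((a.trans a.symm).trans c) c
  | retrace_end {x y z : M} (c : Curve d x y) (a : Curve d y z) :
      CurveEquiv (c.trans (a.trans a.symm)) c

theorem IsReparametrization.reverse {φ : ℝ → ℝ} (h : IsReparametrization φ) :
    IsReparametrization (fun t => 1 - φ (1 - t)) := by
  refine ⟨by simp [h.map_one], by simp [h.map_zero], ?_⟩
  have := PiecewiseOn.reverse (Q := fun a b =>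
    AnalyticOn ℝ (fun t => 1 - φ (1 - t)) (Icc a b) ∧
      ∀ t ∈ Icc a b, 0 < derivWithin (fun t => 1 - φ (1 - t)) (Icc a b) t) h.piecewise ?_
  · simpa using this
  · rintro s t hst ⟨ha, hd⟩
    have hm : ∀ u ∈ Icc (1 - t) (1 - s), 1 - u ∈ Icc s t := fun u hu =>
      ⟨by linarith [hu.2], by linarith [hu.1]⟩
    refine ⟨?_, fun u hu => ?_⟩
    · exact analyticOn_const.sub
        (ha.comp (analyticOn_const.sub analyticOn_id) hm)
    · have h1 : HasDerivWithinAt φ (derivWithin φ (Icc s t) (1 - u)) (Icc s t) (1 - u) :=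
        ((ha.differentiableOn) _ (hm u hu)).hasDerivWithinAt
      have h2 : HasDerivWithinAt (fun u : ℝ => 1 - u) (-1) (Icc (1 - t) (1 - s)) u := by
        simpa using ((hasDerivAt_id u).const_sub 1).hasDerivWithinAt
      have h3 := (h1.comp u h2 hm).const_sub 1
      have h4 : derivWithin (fun t => 1 - φ (1 - t)) (Icc (1 - t) (1 - s)) u
          = derivWithin φ (Icc s t) (1 - u) := by
        have := h3.derivWithin (uniqueDiffOn_Icc (by linarith) u hu)
        simpa using this
      rw [h4]
      exact hd _ (hm u hu)

theorem Curve.symm_trans {x y z : M} (c₁ : Curve d x y) (c₂ : Curve d y z) :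
    (c₁.trans c₂).symm = c₂.symm.trans c₁.symm :=
  Curve.ext (Path.trans_symm _ _)

theorem Curve.symm_symm {x y : M} (c : Curve d x y) : c.symm.symm = c :=
  Curve.ext (Path.symm_symm _)

theorem CurveEquiv.inv {x y : M} {c c' : Curve d x y} (h : CurveEquiv c c') :
    CurveEquiv c.symm c'.symm := by
  induction h with
  | refl c => exact .refl _
  | symm _ ih => exact .symm ih
  | trans _ _ ih₁ ih₂ => exact .trans ih₁ ih₂
  | comp _ _ ih₁ ih₂ =>
    rw [Curve.symm_trans, Curve.symm_trans]
    exact .comp ih₂ ih₁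
  | reparam φ hφ h =>
    refine .reparam (fun t => 1 - φ (1 - t)) hφ.reverse fun t ht => ?_
    change (Path.symm _).extend t = (Path.symm _).extend _
    rw [Path.extend_symm_apply, Path.extend_symm_apply,
      h (1 - t) ⟨by linarith [ht.2], by linarith [ht.1]⟩, sub_sub_cancel]
  | retrace_start a c =>
    rw [Curve.symm_trans, Curve.symm_trans, Curve.symm_symm]
    exact .retrace_end _ _
  | retrace_end c a =>
    rw [Curve.symm_trans, Curve.symm_trans, Curve.symm_symm]
    exact .retrace_start _ _

/-- The piecewise affine reparametrization behind associativity. -/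
theorem isReparametrization_assoc : IsReparametrization
    (fun t : ℝ => if t ≤ 1 / 4 then 2 * t else if t ≤ 1 / 2 then t + 1 / 4 else 1 / 2 * (t + 1)) := by
  refine ⟨by norm_num, by norm_num, ?_⟩
  have key : ∀ (φ : ℝ → ℝ) (k l a b : ℝ), a < b → 0 < k → (∀ t ∈ Icc a b, φ t = k * t + l) →
      PiecewiseOn (fun a b => AnalyticOn ℝ φ (Icc a b) ∧
        ∀ t ∈ Icc a b, 0 < derivWithin φ (Icc a b) t) a b := by
    intro φ k l a b hab hk h
    refine PiecewiseOn.single hab ⟨?_, fun t ht => ?_⟩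
    · exact ((analyticOn_const.mul analyticOn_id).add analyticOn_const).congr h
    · have h1 : HasDerivWithinAt (fun t : ℝ => k * t + l) k (Icc a b) t := by
        simpa using (((hasDerivAt_id t).const_mul k).add_const l).hasDerivWithinAt
      rw [(h1.congr h (h t ht)).derivWithin (uniqueDiffOn_Icc hab t ht)]
      exact hk
  refine ((key _ 2 0 0 (1 / 4) (by norm_num) (by norm_num) ?_).trans
    (key _ 1 (1 / 4) (1 / 4) (1 / 2) (by norm_num) (by norm_num) ?_)).trans
    (key _ (1 / 2) (1 / 2) (1 / 2) 1 (by norm_num) (by norm_num) ?_)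
  all_goals
    intro t ht
    obtain ⟨h1, h2⟩ := ht
    try dsimp only
    split_ifs <;> linarith

theorem CurveEquiv.assoc {w x y z : M} (p : Curve d w x) (q : Curve d x y) (r : Curve d y z) :
    CurveEquiv ((p.trans q).trans r) (p.trans (q.trans r)) := by
  refine .symm (.reparam _ isReparametrization_assoc fun t ht => ?_)
  change ((p.path.trans q.path).trans r.path).extend t = (p.path.trans (q.path.trans r.path)).extend _
  obtain ⟨h0, h1⟩ := ht
  split_ifs with h2 h3
  · rw [Path.extend_trans_of_le_half _ _ (by linarith), Path.extend_trans_of_le_half _ _ (by linarith),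
      Path.extend_trans_of_le_half _ _ (by linarith)]
  · rw [Path.extend_trans_of_le_half _ _ (by linarith), Path.extend_trans_of_half_le _ _ (by linarith),
      Path.extend_trans_of_half_le _ _ (by linarith), Path.extend_trans_of_le_half _ _ (by linarith)]
    congr 1; ring
  · rw [Path.extend_trans_of_half_le _ _ (by linarith), Path.extend_trans_of_half_le _ _ (by linarith),
      Path.extend_trans_of_half_le _ _ (by linarith)]
    congr 1; ring

theorem CurveEquiv.trans_symm_self {x y : M} (c : Curve d x y) :
    CurveEquiv (c.trans c.symm) (Curve.refl x) := by
  have h : (Curve.refl (d := d) x) = (Curve.refl x).trans (Curve.refl x).symm :=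
    Curve.ext Path.refl_trans_refl.symm
  have h1 := CurveEquiv.retrace_start c (Curve.refl x)
  have h2 := CurveEquiv.retrace_end (c.trans c.symm) (Curve.refl x)
  rw [← h] at h2
  exact .trans (.symm h2) h1

/-- Curves from `x` to `y` with their equivalence. -/
instance Curve.setoid (x y : M) : Setoid (Curve d x y) where
  r := CurveEquiv
  iseqv := ⟨.refl, .symm, .trans⟩

end Curves

/-! ## The groupoid of paths -/

section PathGroupoid

/-- The groupoid `𝒫` of paths: its objects are the points of `M`, its arrows the equivalence classes
of piecewise analytic curves. -/
def PathGroupoid (_d : ℕ) (M : Type*) : Type _ := M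

variable {d : ℕ} {M : Type*} [TopologicalSpace M] [ChartedSpace (EuclideanSpace ℝ (Fin d)) M]

/-- The composition `p ≫ q` runs first through `p` and then through `q`
(so it is the path usually written `q p`). -/
instance PathGroupoid.groupoid : Groupoid (PathGroupoid d M) where
  Hom x y := Quotient (Curve.setoid (d := d) (M := M) x y)
  id x := Quotient.mk _ (Curve.refl (M := M) x)
  comp p q := Quotient.map₂ Curve.trans (fun _ _ h₁ _ _ h₂ => CurveEquiv.comp h₁ h₂) p q
  inv p := Quotient.map Curve.symm (fun _ _ h => CurveEquiv.inv h) p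
  id_comp := by
    rintro x y ⟨c⟩
    refine Quotient.sound ?_
    have h : (Curve.refl (d := d) (M := M) x) =
        (Curve.refl (M := M) x).trans (Curve.refl (M := M) x).symm := Curve.ext Path.refl_trans_refl.symm
    rw [h]
    exact CurveEquiv.retrace_start _ c
  comp_id := by
    rintro x y ⟨c⟩
    refine Quotient.sound ?_
    have h : (Curve.refl (d := d) (M := M) y) =
        (Curve.refl (M := M) y).trans (Curve.refl (M := M) y).symm := Curve.ext Path.refl_trans_refl.symm
    rw [h]
    exact CurveEquiv.retrace_end c _
  assoc := by
    rintro w x y z ⟨p⟩ ⟨q⟩ ⟨r⟩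
    exact Quotient.sound (CurveEquiv.assoc p q r)
  inv_comp := by
    rintro x y ⟨c⟩
    refine Quotient.sound ?_
    have h := CurveEquiv.trans_symm_self (d := d) (M := M) (Curve.symm c)
    rwa [Curve.symm_symm c] at h
  comp_inv := by
    rintro x y ⟨c⟩
    exact Quotient.sound (CurveEquiv.trans_symm_self (d := d) (M := M) c)

/-- The arrow of the path groupoid represented by a curve. -/
def Curve.toHom {x y : M} (c : Curve d x y) :
    (show PathGroupoid d M from x) ⟶ (show PathGroupoid d M from y) :=
  Quotient.mk (Curve.setoid x y) c

variable (d M) in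
/-- A curve that is an analytic arc in its whole domain. It represents an edge, `e = [c]`. -/
structure AnalyticCurve where
  source : M
  target : M
  curve : Curve d source target
  isAnalyticArc : IsAnalyticArc d curve.path.extend 0 1

/-- The edge represented by an analytic curve. -/
def AnalyticCurve.edge (c : AnalyticCurve d M) :
    (show PathGroupoid d M from c.source) ⟶ (show PathGroupoid d M from c.target) := c.curve.toHom

/-- The image `σ(e) = c([0, 1])` of the edge `e = [c]`. -/
def AnalyticCurve.image (c : AnalyticCurve d M) : Set M := range c.curve.path

/-- The edges represented by the given curves form an independent set: distinct ones can intersect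
each other only at their sources and ranges (as `i`, `j` can be exchanged, an intersection point is
an end point of both). -/
def Independent {n : ℕ} (e : Fin n → AnalyticCurve d M) : Prop :=
  ∀ i j, i ≠ j → (e i).image ∩ (e j).image ⊆ {(e i).source, (e i).target}

/-- The subgroupoid generated by the given edges. -/
def edgeSubgroupoid {n : ℕ} (e : Fin n → AnalyticCurve d M) : Subgroupoid (PathGroupoid d M) :=
  Subgroupoid.generated fun x y =>
    {p | ∃ i, (⟨x, y, p⟩ : Σ x y : PathGroupoid d M, x ⟶ y) = ⟨_, _, (e i).edge⟩}

variable (d M) in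
/-- The set `ℒ` of tame subgroupoids: those generated by (finite) independent sets of edges. It is
partially ordered by inclusion. -/
def TameSubgroupoid : Type _ :=
  {L : Subgroupoid (PathGroupoid d M) //
    ∃ (n : ℕ) (e : Fin n → AnalyticCurve d M), Independent e ∧ L = edgeSubgroupoid e}

instance : PartialOrder (TameSubgroupoid d M) :=
  inferInstanceAs (PartialOrder {L : Subgroupoid (PathGroupoid d M) //
    ∃ (n : ℕ) (e : Fin n → AnalyticCurve d M), Independent e ∧ L = edgeSubgroupoid e})

end PathGroupoid

/-! ## Morphisms from a groupoid to a group -/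

section Morphisms

/-- `Hom[C, G]`, the functors from the groupoid `C` to the group `G` (seen as a groupoid with one
object, in which `p ≫ q` is the product `q * p`). -/
def GroupoidHom (C : Type*) [Groupoid C] (G : Type*) [Group G] : Type _ := C ⥤ SingleObj G

variable {C : Type*} [Groupoid C] {G : Type*} [Group G]

/-- The value `A(p) ∈ G` of a morphism at an arrow. -/
def GroupoidHom.eval (A : GroupoidHom C G) {x y : C} (p : x ⟶ y) : G :=
  CategoryTheory.Functor.map (C := C) (D := SingleObj G) A p

theorem GroupoidHom.eval_comp (A : GroupoidHom C G) {x y z : C} (p : x ⟶ y) (q : y ⟶ z) :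
    A.eval (p ≫ q) = A.eval q * A.eval p :=
  CategoryTheory.Functor.map_comp (C := C) (D := SingleObj G) A p q

theorem GroupoidHom.eval_id (A : GroupoidHom C G) (x : C) : A.eval (𝟙 x) = 1 :=
  CategoryTheory.Functor.map_id (C := C) (D := SingleObj G) A x

theorem GroupoidHom.eval_inv (A : GroupoidHom C G) {x y : C} (p : x ⟶ y) :
    A.eval (Groupoid.inv p) = (A.eval p)⁻¹ := by
  rw [eq_inv_iff_mul_eq_one, ← A.eval_comp, Groupoid.comp_inv, A.eval_id]

/-- The pull-back of morphisms along a functor of groupoids. -/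
def GroupoidHom.comap {D : Type*} [Groupoid D] (F : C ⥤ D) (A : GroupoidHom D G) :
    GroupoidHom C G :=
  F ⋙ (show D ⥤ SingleObj G from A)

/-- The weakest topology such that the evaluation maps `A ↦ A(p)` are continuous
for all arrows `p`. -/
instance [TopologicalSpace G] : TopologicalSpace (GroupoidHom C G) :=
  ⨅ (x : C) (y : C) (p : x ⟶ y), TopologicalSpace.induced (fun A => A.eval p) inferInstance

instance [TopologicalSpace G] : MeasurableSpace (GroupoidHom C G) := borel _

instance [TopologicalSpace G] : BorelSpace (GroupoidHom C G) := ⟨rfl⟩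

end Morphisms

/-! ## Generalized connections and their projections -/

section Connections

variable {d : ℕ} {M : Type*} [TopologicalSpace M] [ChartedSpace (EuclideanSpace ℝ (Fin d)) M]

variable (d M) in
/-- The space `𝒜̄` of generalized connections, `Hom[𝒫, G]`. -/
abbrev GeneralizedConnection (G : Type*) [Group G] : Type _ := GroupoidHom (PathGroupoid d M) G

/-- The space `𝒜_L = Hom[L, G]` for a tame subgroupoid `L`. -/
abbrev ConnectionOn (L : TameSubgroupoid d M) (G : Type*) [Group G] : Type _ :=
  GroupoidHom L.1.objs G

variable {G : Type*} [Group G]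

/-- The restriction `p_L : 𝒜̄ → 𝒜_L`. -/
def restrictTame (L : TameSubgroupoid d M) :
    GeneralizedConnection d M G → ConnectionOn L G :=
  GroupoidHom.comap L.1.hom

/-- The restriction `p_{L,L'} : 𝒜_{L'} → 𝒜_L` for `L ≤ L'`. -/
def restrictTameOfLE {L L' : TameSubgroupoid d M} (h : L ≤ L') :
    ConnectionOn L' G → ConnectionOn L G :=
  GroupoidHom.comap (Subgroupoid.inclusion (show L.1 ≤ L'.1 from h))

/-- A generator of an edge subgroupoid, as an arrow of that subgroupoid. -/
theorem edge_mem {n : ℕ} (e : Fin n → AnalyticCurve d M) (i : Fin n) :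
    (e i).edge ∈ (edgeSubgroupoid e).arrows (e i).source (e i).target :=
  Subgroupoid.subset_generated _ _ _ ⟨i, rfl⟩

/-- The map `A ↦ (A(e₁), …, A(eₙ))` on `Hom[L, G]`, for `L` generated by `e₁, …, eₙ`. -/
def evalEdges {n : ℕ} (e : Fin n → AnalyticCurve d M)
    (A : GroupoidHom (edgeSubgroupoid e).objs G) : Fin n → G := fun i =>
  A.eval (x := ⟨_, Subgroupoid.mem_objs_of_src _ (edge_mem e i)⟩)
    (y := ⟨_, Subgroupoid.mem_objs_of_tgt _ (edge_mem e i)⟩) ⟨_, edge_mem e i⟩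

/-- The topology of `Hom[L, G]` is the one induced from `Gⁿ` by `A ↦ (A(e₁), …, A(eₙ))`,
for any generators `e₁, …, eₙ` of `L`. -/
theorem topology_eq_induced_evalEdges [TopologicalSpace G] [IsTopologicalGroup G] {n : ℕ}
    (e : Fin n → AnalyticCurve d M) :
    (inferInstance : TopologicalSpace (GroupoidHom (edgeSubgroupoid e).objs G)) =
      TopologicalSpace.induced (evalEdges e) inferInstance := by
  apply le_antisymm
  · rw [← continuous_iff_le_induced]
    refine continuous_pi fun i => continuous_iff_le_induced.2 ?_
    exact (iInf_le _ _).trans ((iInf_le _ _).trans (iInf_le _ _))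
  · refine le_iInf fun x => le_iInf fun y => le_iInf fun p => ?_
    rw [← continuous_iff_le_induced]
    let τ : TopologicalSpace (GroupoidHom (edgeSubgroupoid e).objs G) :=
      TopologicalSpace.induced (evalEdges e) inferInstance
    let S : Subgroupoid (PathGroupoid d M) :=
      { arrows := fun x y => {p : x ⟶ y | ∃ hp : p ∈ (edgeSubgroupoid e).arrows x y,
          @Continuous _ _ τ _ fun A : GroupoidHom (edgeSubgroupoid e).objs G =>
            A.eval (x := ⟨_, Subgroupoid.mem_objs_of_src _ hp⟩)
              (y := ⟨_, Subgroupoid.mem_objs_of_tgt _ hp⟩) ⟨p, hp⟩}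
        inv := by
          rintro x y p ⟨hp, hc⟩
          refine ⟨Subgroupoid.inv _ hp, ?_⟩
          refine Continuous.congr (@Continuous.comp _ _ _ τ _ _ _ _ continuous_inv hc) fun A => ?_
          exact (A.eval_inv _).symm
        mul := by
          rintro x y z p ⟨hp, hcp⟩ q ⟨hq, hcq⟩
          refine ⟨Subgroupoid.mul _ hp hq, ?_⟩
          refine Continuous.congr (@Continuous.comp _ _ _ τ _ _ _ _ continuous_mul
            (@Continuous.prodMk _ _ _ _ _ τ _ _ hcq hcp)) fun A => ?_
          exact (A.eval_comp (x := ⟨_, Subgroupoid.mem_objs_of_src _ hp⟩)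
            (y := ⟨_, Subgroupoid.mem_objs_of_tgt _ hp⟩)
            (z := ⟨_, Subgroupoid.mem_objs_of_tgt _ hq⟩) ⟨p, hp⟩ ⟨q, hq⟩).symm }
    have hS : edgeSubgroupoid e ≤ S := by
      refine sInf_le ?_
      rintro x y p ⟨i, hi⟩
      cases hi
      refine ⟨edge_mem e i, ?_⟩
      have h1 : @Continuous _ _ τ _ (evalEdges (G := G) e) := continuous_induced_dom
      exact @Continuous.comp _ _ _ τ _ _ _ _ (continuous_apply i) h1
    obtain ⟨_, hc⟩ := (Subgroupoid.le_iff _ _).1 hS p.2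
    exact hc

end Connections

/-! ## Measures -/

/-- Regular Borel probability measures on a topological space (with its Borel `σ`-algebra). -/
def RegularProbability (X : Type*) [TopologicalSpace X] [MeasurableSpace X] [BorelSpace X] :
    Type _ :=
  {μ : Measure X // IsProbabilityMeasure μ ∧ μ.Regular}

/-- Consistent families `(μ_L)` of regular Borel probability measures on the spaces `𝒜_L`:
`μ_L = (p_{L,L'})_* μ_{L'}` whenever `L ≤ L'`. -/
def ConsistentFamily (d : ℕ) (M : Type*) [TopologicalSpace M]
    [ChartedSpace (EuclideanSpace ℝ (Fin d)) M] (G : Type*) [Group G] [TopologicalSpace G] :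
    Type _ :=
  {μ : ∀ L : TameSubgroupoid d M, RegularProbability (ConnectionOn L G) //
    ∀ (L L' : TameSubgroupoid d M) (h : L ≤ L'), (μ L).1 = (μ L').1.map (restrictTameOfLE h)}

end

/-!
The two sides of the bijection are compared through the inverse limit of the spaces `𝒜_L`.

*Directedness.* Any finite family of edges lies in the subgroupoid generated by an independent family
(`exists_independent_refinement`), so `ℒ` is directed and every nontrivial path lies in some `L`. The
reason is that the arcs are analytic. In a chart, an arc `g` with nonzero velocity has an analytic left
inverse along a linear functional `ℓ`, so an incidence `g σ = h τ` forces `σ = φ τ` for an analytic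
function `φ`, and the zeros of `h - g ∘ φ` are isolated unless this function vanishes identically.
Hence near any pair of parameters the incidences of two arcs either take place at a single point or
form the graph of an immersive analytic change of parameter (`incidence_of_analyticAt`). By compactness
there is a finite set `P` of points of the manifold containing all the isolated incidences and
subdividing the arcs so finely that this dichotomy holds for any two of the pieces obtained by cutting
the arcs at the points of `P`. Two such pieces then have disjoint interiors or agree up to a change of
parameter and orientation (`LocalPosition.disjoint_or_eq`); a maximal set of pieces with disjoint
interiors is an independent family that generates all the given arcs.

*Compactness.* `Hom[C, G]` is a closed subspace of a power of `G`, hence compact Hausdorff. By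
directedness, a closed subset of `𝒜_L` that meets the image of every `𝒜_{L'}` with `L ≤ L'` meets the
image of `𝒜̄` (`exists_restrictTame_mem`): extend morphisms on the `L'` by `1` and pass to a limit along
an ultrafilter. This replaces the surjectivity of the projections `p_L`.

*Measures.* Cylinder functions `f ∘ p_L` form a dense subalgebra of `C(𝒜̄)` by the Stone–Weierstrass
theorem, which gives injectivity (`measure_ext_of_map_eq`). For surjectivity
(`exists_measure_of_consistent`), the compactness statement shows that `f ∘ p_L ↦ ∫ f dμ_L` is a well
defined positive functional on cylinder functions. It extends to a positive functional on `C(𝒜̄)` by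
M. Riesz' extension theorem, which is integration against a regular measure by the
Riesz–Markov–Kakutani theorem.
-/

/-! ### Measures on inverse limits of compact spaces -/

section InverseLimits

theorem regular_map_of_continuous {X Y : Type*} [TopologicalSpace X] [MeasurableSpace X]
    [BorelSpace X] [TopologicalSpace Y] [T2Space Y] [MeasurableSpace Y] [BorelSpace Y] {μ : Measure X} [IsFiniteMeasure μ] [μ.Regular] {f : X → Y}
    (hf : Continuous f) : (μ.map f).Regular := by
  have : (μ.map f).InnerRegularCompactLTTop := Measure.InnerRegularCompactLTTop.map_of_continuous hf
  infer_instance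

variable {X : Type*} [TopologicalSpace X] [CompactSpace X] [T2Space X] [MeasurableSpace X]
  [BorelSpace X]

theorem measure_ext_of_integral_continuousMap {μ μ' : Measure X} [IsFiniteMeasure μ]
    [IsFiniteMeasure μ'] [μ.Regular] [μ'.Regular]
    (h : ∀ f : C(X, ℝ), ∫ x, f x ∂μ = ∫ x, f x ∂μ') : μ = μ' :=
  Measure.ext_of_integral_eq_on_compactlySupported fun f => h f.toContinuousMap

theorem exists_regular_of_positive (Λ : C(X, ℝ) →ₗ[ℝ] ℝ) (hΛ : ∀ f, 0 ≤ f → 0 ≤ Λ f) :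
    ∃ μ : Measure X, IsFiniteMeasure μ ∧ μ.Regular ∧ ∀ f : C(X, ℝ), ∫ x, f x ∂μ = Λ f := by
  let Λ' : CompactlySupportedContinuousMap X ℝ →ₗ[ℝ] ℝ :=
    { toFun := fun f => Λ f.toContinuousMap
      map_add' := fun f g => Λ.map_add f.toContinuousMap g.toContinuousMap
      map_smul' := fun r f => Λ.map_smul r f.toContinuousMap }
  let Λ'' : CompactlySupportedContinuousMap X ℝ →ₚ[ℝ] ℝ :=
    PositiveLinearMap.mk₀ Λ' fun f hf => hΛ _ fun x => hf x
  refine ⟨RealRMK.rieszMeasure Λ'', inferInstance, inferInstance, fun f => ?_⟩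
  exact RealRMK.integral_rieszMeasure Λ'' ⟨f, HasCompactSupport.of_compactSpace _⟩

variable {ι : Type*} [Preorder ι] [IsDirectedOrder ι] [Nonempty ι]
  {Y : ι → Type*} [∀ i, TopologicalSpace (Y i)] [∀ i, CompactSpace (Y i)] [∀ i, T2Space (Y i)]
  [∀ i, MeasurableSpace (Y i)] [∀ i, BorelSpace (Y i)]
  (p : ∀ i, C(X, Y i)) (q : ∀ i j, i ≤ j → C(Y j, Y i))

/-- The algebra of cylinder functions `f ∘ p i`, for a compatible family of maps `p i` from `X` to a
directed system. -/
def cylinderAlgebra (hqp : ∀ i j h, (q i j h).comp (p j) = p i) : Subalgebra ℝ C(X, ℝ) where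
  carrier := {F | ∃ i, ∃ f : C(Y i, ℝ), F = f.comp (p i)}
  mul_mem' := by
    rintro _ _ ⟨i, f, rfl⟩ ⟨j, g, rfl⟩
    obtain ⟨k, hik, hjk⟩ := exists_ge_ge i j
    refine ⟨k, f.comp (q i k hik) * g.comp (q j k hjk), ?_⟩
    rw [ContinuousMap.mul_comp, ContinuousMap.comp_assoc, ContinuousMap.comp_assoc, hqp, hqp]
  add_mem' := by
    rintro _ _ ⟨i, f, rfl⟩ ⟨j, g, rfl⟩
    obtain ⟨k, hik, hjk⟩ := exists_ge_ge i j
    refine ⟨k, f.comp (q i k hik) + g.comp (q j k hjk), ?_⟩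
    rw [ContinuousMap.add_comp, ContinuousMap.comp_assoc, ContinuousMap.comp_assoc, hqp, hqp]
  algebraMap_mem' := fun r =>
    ⟨Classical.arbitrary ι, algebraMap ℝ _ r, by ext; simp⟩

/-- A regular measure on a compact space is determined by its images under a directed family of maps
that separates points, because cylinder functions are dense. -/
theorem measure_ext_of_map_eq (hqp : ∀ i j h, (q i j h).comp (p j) = p i)
    (sep : ∀ x y, (∀ i, p i x = p i y) → x = y)
    {μ μ' : Measure X} [IsFiniteMeasure μ] [IsFiniteMeasure μ'] [μ.Regular] [μ'.Regular]
    (h : ∀ i, μ.map (p i) = μ'.map (p i)) : μ = μ' := by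
  refine measure_ext_of_integral_continuousMap fun F => ?_
  have hsep : (cylinderAlgebra p q hqp).SeparatesPoints := by
    intro x y hxy
    obtain ⟨i, hi⟩ : ∃ i, p i x ≠ p i y := by
      by_contra! hc
      exact hxy (sep x y hc)
    obtain ⟨f, h0, h1, -⟩ := exists_continuous_zero_one_of_isClosed
      (isClosed_singleton (x := p i x)) (isClosed_singleton (x := p i y)) (by simpa using hi)
    refine ⟨_, ⟨f.comp (p i), ⟨i, f, rfl⟩, rfl⟩, ?_⟩
    have e0 := h0 rfl
    have e1 := h1 rfl
    simp [e0, e1]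
  have hdense := ContinuousMap.subalgebra_topologicalClosure_eq_top_of_separatesPoints _ hsep
  have hcont : ∀ (m : Measure X) [IsFiniteMeasure m],
      Continuous fun F : C(X, ℝ) => ∫ x, F x ∂m := by
    intro m _
    have h1 : (fun F : C(X, ℝ) => ∫ x, F x ∂m) = fun F =>
        ∫ x, (BoundedContinuousFunction.mkOfCompact F) x ∂m := rfl
    rw [h1]
    refine LipschitzWith.continuous (K := ⟨m.real univ, measureReal_nonneg⟩)
      (LipschitzWith.of_dist_le_mul fun F F' => ?_)
    rw [dist_eq_norm, ← integral_sub (BoundedContinuousFunction.integrable _ _)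
      (BoundedContinuousFunction.integrable _ _)]
    refine (norm_integral_le_of_norm_le_const (C := dist F F') ?_).trans ?_
    · refine Filter.Eventually.of_forall fun x => ?_
      rw [← dist_eq_norm]
      exact ContinuousMap.dist_apply_le_dist x
    · exact (mul_comm _ _).le
  have hF : F ∈ closure (cylinderAlgebra p q hqp : Set C(X, ℝ)) := by
    rw [← Subalgebra.topologicalClosure_coe, hdense]
    trivial
  have hcl : IsClosed {F : C(X, ℝ) | ∫ x, F x ∂μ = ∫ x, F x ∂μ'} :=
    isClosed_eq (hcont μ) (hcont μ')
  refine closure_minimal ?_ hcl hF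
  rintro _ ⟨i, f, rfl⟩
  have e1 := integral_map (μ := μ) (p i).continuous.aemeasurable
    (f := f) (f.continuous.measurable.aestronglyMeasurable)
  have e2 := integral_map (μ := μ') (p i).continuous.aemeasurable
    (f := f) (f.continuous.measurable.aestronglyMeasurable)
  rw [h i] at e1
  exact e1.symm.trans e2

/-- A consistent family of regular probability measures comes from a regular probability measure on
`X`, provided that every closed subset of some `Y i` that meets the image of each `Y j`, `i ≤ j`, meets
the image of `X`. The family `p` need neither be surjective nor separate points. -/
theorem exists_measure_of_consistent (hqp : ∀ i j h, (q i j h).comp (p j) = p i)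
    (lift : ∀ i (K : Set (Y i)), IsClosed K → (∀ j (h : i ≤ j), ∃ y, q i j h y ∈ K) →
      ∃ x, p i x ∈ K)
    (ν : ∀ i, Measure (Y i)) [∀ i, IsProbabilityMeasure (ν i)] [∀ i, (ν i).Regular]
    (hν : ∀ i j (h : i ≤ j), ν i = (ν j).map (q i j h)) :
    ∃ μ : Measure X, IsProbabilityMeasure μ ∧ μ.Regular ∧ ∀ i, μ.map (p i) = ν i := by
  have hint : ∀ i (f : C(Y i, ℝ)), Integrable f (ν i) := fun i f =>
    (BoundedContinuousFunction.mkOfCompact f).integrable _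
  have hmap : ∀ i j (h : i ≤ j) (f : C(Y i, ℝ)),
      ∫ y, f.comp (q i j h) y ∂(ν j) = ∫ y, f y ∂(ν i) := by
    intro i j h f
    rw [hν i j h, integral_map (q i j h).continuous.aemeasurable
      f.continuous.measurable.aestronglyMeasurable]
    rfl
  have hpos : ∀ i (f : C(Y i, ℝ)), 0 ≤ f.comp (p i) → 0 ≤ ∫ y, f y ∂(ν i) := by
    intro i f hf
    refine le_of_forall_pos_le_add fun ε hε => ?_
    -- the closed set where `f ≤ -ε` misses the image of `p i`, hence that of some `q i j`
    have hK : IsClosed {y | f y ≤ -ε} := isClosed_le f.continuous continuous_const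
    have hj : ∃ j, ∃ h : i ≤ j, ∀ y, q i j h y ∉ {y | f y ≤ -ε} := by
      by_contra! hc
      obtain ⟨x, hx⟩ := lift i _ hK hc
      have h1 : 0 ≤ f (p i x) := hf x
      have h2 : f (p i x) ≤ -ε := hx
      linarith
    obtain ⟨j, h, hy⟩ := hj
    rw [← hmap i j h f]
    have h3 : ∫ _, -ε ∂(ν j) ≤ ∫ y, f.comp (q i j h) y ∂(ν j) := by
      refine integral_mono (integrable_const _) (hint _ _) fun y => ?_
      have := hy y
      simp only [mem_ofPred_eq, not_le] at this
      exact this.le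
    simp at h3
    simpa using by linarith
  -- the graph of the functional `f ∘ p i ↦ ∫ f ∂(ν i)` on cylinder functions
  let Γ : Submodule ℝ (C(X, ℝ) × ℝ) :=
    { carrier := {z | ∃ i, ∃ f : C(Y i, ℝ), z = (f.comp (p i), ∫ y, f y ∂(ν i))}
      zero_mem' := ⟨Classical.arbitrary ι, 0, by ext <;> simp⟩
      add_mem' := by
        rintro _ _ ⟨i, f, rfl⟩ ⟨j, g, rfl⟩
        obtain ⟨k, hik, hjk⟩ := exists_ge_ge i j
        refine ⟨k, f.comp (q i k hik) + g.comp (q j k hjk), ?_⟩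
        refine Prod.ext ?_ ?_
        · rw [ContinuousMap.add_comp, ContinuousMap.comp_assoc, ContinuousMap.comp_assoc, hqp, hqp]
          rfl
        · have := integral_add (hint k (f.comp (q i k hik))) (hint k (g.comp (q j k hjk)))
          rw [hmap, hmap] at this
          exact this.symm
      smul_mem' := by
        rintro r _ ⟨i, f, rfl⟩
        refine ⟨i, r • f, Prod.ext ?_ ?_⟩
        · rfl
        · exact (integral_smul r _).symm }
  have hΓpos : ∀ z ∈ Γ, 0 ≤ z.1 → 0 ≤ z.2 := by
    rintro _ ⟨i, f, rfl⟩ h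
    exact hpos i f h
  have hΓ : ∀ z ∈ Γ, z.1 = 0 → z.2 = 0 := by
    intro z hz h0
    have h1 := hΓpos z hz h0.ge
    have h2 := hΓpos (-z) (Γ.neg_mem hz) (by simp [h0])
    simp at h2
    exact le_antisymm h2 h1
  let cone : PointedCone ℝ C(X, ℝ) := PointedCone.positive ℝ C(X, ℝ)
  obtain ⟨Λ, hΛ, hΛpos⟩ := riesz_extension cone Γ.toLinearPMap
    (fun x hx => hΓpos _ (Submodule.mem_graph_toLinearPMap hΓ x) hx) (by
      -- constants are cylinder functions, so every function is bounded below by one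
      intro y
      let i := Classical.arbitrary ι
      have hm : (ContinuousMap.const X ‖y‖, ‖y‖) ∈ Γ :=
        ⟨i, ContinuousMap.const _ ‖y‖, by ext <;> simp⟩
      refine ⟨⟨ContinuousMap.const X ‖y‖, _, hm, rfl⟩, ?_⟩
      refine (PointedCone.mem_positive ℝ _).2 fun x => ?_
      have := (abs_le.1 (y.norm_coe_le_norm x)).1
      simp
      linarith)
  obtain ⟨μ, hμf, hμr, hμ⟩ := exists_regular_of_positive Λ
    fun f hf => hΛpos f ((PointedCone.mem_positive ℝ _).2 hf)
  have hμi : ∀ i (f : C(Y i, ℝ)), ∫ x, f (p i x) ∂μ = ∫ y, f y ∂(ν i) := by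
    intro i f
    have hm : (f.comp (p i), ∫ y, f y ∂(ν i)) ∈ Γ := ⟨i, f, rfl⟩
    have h1 := hμ (f.comp (p i))
    have h2 := hΛ ⟨f.comp (p i), _, hm, rfl⟩
    have h3 := Submodule.mem_graph_toLinearPMap hΓ ⟨f.comp (p i), _, hm, rfl⟩
    have h4 := hΓ _ (Γ.sub_mem hm h3) (by simp)
    simp only [Prod.snd_sub, sub_eq_zero] at h4
    exact (h1.trans h2).trans h4.symm
  have hmapi : ∀ i, μ.map (p i) = ν i := by
    intro i
    have := regular_map_of_continuous (μ := μ) (p i).continuous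
    refine measure_ext_of_integral_continuousMap fun f => ?_
    rw [integral_map (p i).continuous.aemeasurable
      f.continuous.measurable.aestronglyMeasurable, hμi]
  refine ⟨μ, ?_, hμr, hmapi⟩
  constructor
  let i := Classical.arbitrary ι
  have := measure_univ (μ := ν i)
  rwa [← hmapi i, Measure.map_apply (p i).continuous.measurable MeasurableSet.univ,
    preimage_univ] at this

end InverseLimits

/-! ### Incidences of analytic arcs -/

section LocalIncidence
open Filter Topology

/-- Near a common point of two immersed analytic curves `g` and `h`, either there is no other
incidence, or the incidences `g σ = h τ` form the graph of an analytic immersion `σ = φ τ`. -/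
theorem incidence_of_analyticAt {E : Type*} [NormedAddCommGroup E] [InnerProductSpace ℝ E]
    [CompleteSpace E] {g h : ℝ → E} {s t : ℝ} (hg : AnalyticAt ℝ g s) (hh : AnalyticAt ℝ h t)
    (hg' : deriv g s ≠ 0) (hh' : deriv h t ≠ 0) (hst : g s = h t) :
    (∀ᶠ z : ℝ × ℝ in 𝓝 (s, t), g z.1 = h z.2 → z = (s, t)) ∨
    ∃ φ : ℝ → ℝ, AnalyticAt ℝ φ t ∧ deriv φ t ≠ 0 ∧
      ∀ᶠ z : ℝ × ℝ in 𝓝 (s, t), g z.1 = h z.2 ↔ z.1 = φ z.2 := by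
  -- composing with `ℓ` makes `g` invertible near `s`
  let ℓ : E →L[ℝ] ℝ := innerSL ℝ (deriv g s)
  let u : ℝ → ℝ := fun σ => ℓ (g σ)
  have hu : AnalyticAt ℝ u s := ℓ.analyticAt _ |>.comp hg
  have hu' : deriv u s ≠ 0 := by
    have : HasDerivAt u (ℓ (deriv g s)) s :=
      ℓ.hasFDerivAt.comp_hasDerivAt s hg.differentiableAt.hasDerivAt
    rw [this.deriv]
    simpa [ℓ] using hg'
  let ψ := hu.hasStrictDerivAt.localInverse _ _ _ hu'
  have hψ : AnalyticAt ℝ ψ (u s) := hu.analyticAt_localInverse hu'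
  have hψu : ∀ᶠ σ in 𝓝 s, ψ (u σ) = σ :=
    hu.hasStrictDerivAt.eventually_left_inverse hu'
  let φ : ℝ → ℝ := fun τ => ψ (ℓ (h τ))
  have hℓst : u s = ℓ (h t) := by simp only [u, hst]
  have hφ : AnalyticAt ℝ φ t := by
    have h1 : AnalyticAt ℝ (fun τ => ℓ (h τ)) t := ℓ.analyticAt _ |>.comp hh
    refine AnalyticAt.comp (g := ψ) ?_ h1
    rwa [← hℓst]
  have hφt : φ t = s := by
    change ψ (ℓ (h t)) = s
    rw [← hℓst]
    exact hψu.self_of_nhds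
  have hgφ : AnalyticAt ℝ (fun τ => g (φ τ)) t := by
    refine AnalyticAt.comp (g := g) ?_ hφ
    rwa [hφt]
  -- an incidence near `(s, t)` lies on the graph of `φ`
  have hgraph : ∀ᶠ z : ℝ × ℝ in 𝓝 (s, t), g z.1 = h z.2 → z.1 = φ z.2 := by
    filter_upwards [(continuous_fst.tendsto (s, t)).eventually hψu] with z hz hzz
    rw [← hz]
    simp only [u, φ, hzz]
  rcases (hh.sub hgφ).eventually_eq_zero_or_eventually_ne_zero with h0 | h0
  · right
    have hφ' : deriv φ t ≠ 0 := by
      intro hc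
      have h1 : HasDerivAt (fun τ => g (φ τ)) (deriv φ t • deriv g s) t := by
        have h2 : HasDerivAt g (deriv g s) (φ t) := by
          rw [hφt]
          exact hg.differentiableAt.hasDerivAt
        exact h2.scomp t hφ.differentiableAt.hasDerivAt
      have h3 : h =ᶠ[𝓝 t] fun τ => g (φ τ) := h0.mono fun τ hτ => sub_eq_zero.1 hτ
      apply hh'
      rw [h3.deriv_eq, h1.deriv, hc, zero_smul]
    refine ⟨φ, hφ, hφ', ?_⟩
    filter_upwards [hgraph, (continuous_snd.tendsto (s, t)).eventually h0] with z hz hz0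
    refine ⟨hz, fun hzz => ?_⟩
    rw [hzz]
    exact (sub_eq_zero.1 hz0).symm
  · left
    rw [eventually_nhdsWithin_iff] at h0
    filter_upwards [hgraph, (continuous_snd.tendsto (s, t)).eventually h0] with z hz hz0 hzz
    have h1 := hz hzz
    have h2 : z.2 = t := by
      by_contra hc
      refine hz0 hc (sub_eq_zero.2 ?_)
      change h z.2 = g (φ z.2)
      rw [← h1, hzz]
    refine Prod.ext ?_ h2
    rw [h1, h2, hφt]

/-- Local position of two arcs on `U × V`, with respect to a set `F` of points: either all the
incidences `f σ = f' τ` with `(σ, τ) ∈ U × V` take place at points of `F`, or they are described by an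
analytic change of parameter `σ = φ τ` without critical points. -/
def LocalPosition {M : Type*} (F : Set M) (f f' : ℝ → M) (U V : Set ℝ) : Prop :=
  (∀ σ ∈ U, ∀ τ ∈ V, f σ = f' τ → f σ ∈ F) ∨
  ∃ φ : ℝ → ℝ, (∀ τ ∈ V, AnalyticAt ℝ φ τ ∧ deriv φ τ ≠ 0) ∧
    ∀ σ ∈ U, ∀ τ ∈ V, (f σ = f' τ ↔ σ = φ τ)

theorem LocalPosition.mono {M : Type*} {F F' : Set M} {f f' : ℝ → M} {U U' V V' : Set ℝ}
    (h : LocalPosition F f f' U V) (hF : F ⊆ F') (hU : U' ⊆ U) (hV : V' ⊆ V) :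
    LocalPosition F' f f' U' V' := by
  rcases h with h | ⟨φ, h1, h2⟩
  · exact Or.inl fun σ hσ τ hτ e => hF (h σ (hU hσ) τ (hV hτ) e)
  · exact Or.inr ⟨φ, fun τ hτ => h1 τ (hV hτ), fun σ hσ τ hτ => h2 σ (hU hσ) τ (hV hτ)⟩

variable {d : ℕ} {M : Type*} [TopologicalSpace M] [ChartedSpace (EuclideanSpace ℝ (Fin d)) M]

/-- In a chart, an analytic arc on a closed interval extends to an immersed analytic curve around each
parameter, the end points included. -/
theorem IsAnalyticArc.exists_analyticAt_chart [IsManifold (𝓡 d) ω M] {f : ℝ → M} {a b s : ℝ}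
    (hf : IsAnalyticArc d f a b) (hab : a < b) (hs : s ∈ Icc a b) {x : M} (hx : f s = x) :
    ∃ g : ℝ → EuclideanSpace ℝ (Fin d), AnalyticAt ℝ g s ∧ deriv g s ≠ 0 ∧
      ∀ᶠ σ in 𝓝[Icc a b] s, f σ ∈ (extChartAt (𝓡 d) x).source ∧ extChartAt (𝓡 d) x (f σ) = g σ := by
  subst hx
  have h1 := hf.analytic s hs
  rw [contMDiffWithinAt_iff] at h1
  obtain ⟨hc, h2⟩ := h1
  simp only [mfld_simps, Function.comp_def, chartAt_self_eq] at h2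
  have h3 : AnalyticWithinAt ℝ (fun σ => extChartAt (𝓡 d) (f s) (f σ)) (Icc a b) s := by
    have := h2.analyticWithinAt
    simpa using this
  obtain ⟨g, hg, hga⟩ := analyticWithinAt_iff_exists_analyticAt.1 h3
  rw [insert_eq_of_mem hs] at hg
  refine ⟨g, hga, ?_, ?_⟩
  · intro h0
    have hm : MDifferentiableWithinAt 𝓘(ℝ, ℝ) (𝓡 d) f (Icc a b) s :=
      (hf.analytic s hs).mdifferentiableWithinAt (by simp)
    refine hf.immersion s hs ?_
    rw [mfderivWithin]
    refine (if_pos hm).trans ?_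
    simp only [writtenInExtChartAt, mfld_simps, Function.comp_def, chartAt_self_eq]
    have h4 : HasFDerivWithinAt g (0 : ℝ →L[ℝ] _) (Icc a b) s := by
      have := hga.differentiableAt.hasDerivAt
      rw [h0] at this
      simpa using this.hasFDerivAt.hasFDerivWithinAt
    have h5 := h4.congr_of_eventuallyEq hg (hg.self_of_nhdsWithin hs)
    have := h5.fderivWithin (uniqueDiffOn_Icc hab s hs)
    simp only [mfld_simps] at this ⊢
    exact this
  · have := hc.eventually (extChartAt_source_mem_nhds (I := 𝓡 d) (f s))
    filter_upwards [this, hg] with σ h1 h2 using ⟨h1, h2⟩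

theorem IsAnalyticArc.exists_localPosition [T2Space M] [IsManifold (𝓡 d) ω M] {f f' : ℝ → M}
    {a b a' b' : ℝ} (hf : IsAnalyticArc d f a b) (hf' : IsAnalyticArc d f' a' b') (hab : a < b)
    (hab' : a' < b') {z : ℝ × ℝ} (hz : z ∈ Icc a b ×ˢ Icc a' b') :
    ∃ r > 0, LocalPosition {f z.1} f f' (Icc a b ∩ Metric.ball z.1 r)
      (Icc a' b' ∩ Metric.ball z.2 r) := by
  obtain ⟨s, t⟩ := z
  obtain ⟨hs, ht⟩ := hz
  simp only at hs ht ⊢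
  -- `P` holds at all parameters of the two arcs near `(s, t)` iff it holds on a small box
  have box : ∀ P : ℝ × ℝ → Prop, (∀ᶠ z in 𝓝[Icc a b] s ×ˢ 𝓝[Icc a' b'] t, P z) →
      ∃ r > 0, ∀ σ ∈ Icc a b ∩ Metric.ball s r, ∀ τ ∈ Icc a' b' ∩ Metric.ball t r, P (σ, τ) := by
    intro P hP
    rw [← nhdsWithin_prod_eq] at hP
    obtain ⟨r, hr, h⟩ := Metric.mem_nhdsWithin_iff.1 hP
    refine ⟨r, hr, fun σ hσ τ hτ => h ⟨?_, hσ.1, hτ.1⟩⟩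
    rw [Metric.mem_ball, Prod.dist_eq]
    exact max_lt hσ.2 hτ.2
  by_cases hst : f s = f' t
  · obtain ⟨g, hg, hg', hgf⟩ := hf.exists_analyticAt_chart hab hs rfl
    obtain ⟨h, hh, hh', hhf⟩ := hf'.exists_analyticAt_chart hab' ht hst.symm
    have hgh : g s = h t := by
      rw [← (hgf.self_of_nhdsWithin hs).2, ← (hhf.self_of_nhdsWithin ht).2, hst]
    have key : ∀ᶠ z : ℝ × ℝ in 𝓝[Icc a b] s ×ˢ 𝓝[Icc a' b'] t,
        (f z.1 = f' z.2 ↔ g z.1 = h z.2) := by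
      filter_upwards [hgf.prod_inl _, hhf.prod_inr _] with z h1 h2
      rw [← h1.2, ← h2.2, (extChartAt (𝓡 d) (f s)).injOn.eq_iff h1.1 h2.1]
    have hle : 𝓝[Icc a b] s ×ˢ 𝓝[Icc a' b'] t ≤ 𝓝 (s, t) := by
      rw [← nhdsWithin_prod_eq]
      exact nhdsWithin_le_nhds
    rcases incidence_of_analyticAt hg hh hg' hh' hgh with h0 | ⟨φ, hφ, hφ', h0⟩
    · obtain ⟨r, hr, H⟩ := box _ ((h0.filter_mono hle).and key)
      refine ⟨r, hr, Or.inl fun σ hσ τ hτ e => ?_⟩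
      obtain ⟨h1, h2⟩ := H σ hσ τ hτ
      rw [(Prod.mk.inj (h1 (h2.1 e))).1]
      rfl
    · have hφe : ∀ᶠ τ in 𝓝[Icc a' b'] t, AnalyticAt ℝ φ τ ∧ deriv φ τ ≠ 0 :=
        nhdsWithin_le_nhds (hφ.eventually_analyticAt.and
          (hφ.deriv.continuousAt.eventually_ne hφ'))
      obtain ⟨r, hr, H⟩ := box _ (((h0.filter_mono hle).and key).and (hφe.prod_inr _))
      refine ⟨r, hr, Or.inr ⟨φ, fun τ hτ => (H s ⟨hs, Metric.mem_ball_self hr⟩ τ hτ).2,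
        fun σ hσ τ hτ => ?_⟩⟩
      obtain ⟨⟨h1, h2⟩, -⟩ := H σ hσ τ hτ
      exact h2.trans h1
  · have hc : Tendsto (fun z : ℝ × ℝ => (f z.1, f' z.2)) (𝓝[Icc a b] s ×ˢ 𝓝[Icc a' b'] t)
        (𝓝 (f s, f' t)) := by
      rw [nhds_prod_eq]
      exact Tendsto.prodMap (hf.analytic s hs).continuousWithinAt
        (hf'.analytic t ht).continuousWithinAt
    have hne : ∀ᶠ z : ℝ × ℝ in 𝓝[Icc a b] s ×ˢ 𝓝[Icc a' b'] t, f z.1 ≠ f' z.2 :=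
      hc.eventually (isClosed_diagonal.isOpen_compl.mem_nhds hst)
    obtain ⟨r, hr, H⟩ := box _ hne
    exact ⟨r, hr, Or.inl fun σ hσ τ hτ e => (H σ hσ τ hτ e).elim⟩

/-- By compactness, two arcs are in local position on all boxes of some fixed size, with respect to
one finite set of points. -/
theorem IsAnalyticArc.exists_finite_localPosition [T2Space M] [IsManifold (𝓡 d) ω M]
    {f f' : ℝ → M} {a b a' b' : ℝ} (hf : IsAnalyticArc d f a b) (hf' : IsAnalyticArc d f' a' b')
    (hab : a < b) (hab' : a' < b') :
    ∃ F : Set M, F.Finite ∧ ∃ δ > 0, ∀ s s' t t', s ≤ s' → t ≤ t' → Icc s s' ⊆ Icc a b →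
      Icc t t' ⊆ Icc a' b' → s' - s < δ → t' - t < δ →
      LocalPosition F f f' (Icc s s') (Icc t t') := by
  choose! r hr hpos using fun z hz => hf.exists_localPosition hf' hab hab' (z := z) hz
  have hK : IsCompact (Icc a b ×ˢ Icc a' b') := isCompact_Icc.prod isCompact_Icc
  obtain ⟨T, hTK, hT⟩ := hK.elim_nhds_subcover (fun z => Metric.ball z (r z))
    fun z hz => Metric.ball_mem_nhds z (hr z hz)
  replace hT : Icc a b ×ˢ Icc a' b' ⊆ ⋃ z : T, Metric.ball (z : ℝ × ℝ) (r z) := by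
    simpa only [iUnion_coe_set, Finset.mem_coe, iUnion_subtype] using hT
  obtain ⟨δ, hδ, H⟩ := lebesgue_number_lemma_of_metric hK (fun _ => Metric.isOpen_ball) hT
  refine ⟨(fun z : ℝ × ℝ => f z.1) '' T, T.finite_toSet.image _, δ, hδ, ?_⟩
  intro s s' t t' hs ht hss htt hsδ htδ
  obtain ⟨z, hz⟩ := H (s, t) ⟨hss ⟨le_rfl, hs⟩, htt ⟨le_rfl, ht⟩⟩
  have hball : Icc s s' ×ˢ Icc t t' ⊆ Metric.ball (s, t) δ := by
    rintro ⟨σ, τ⟩ ⟨⟨h1, h2⟩, ⟨h3, h4⟩⟩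
    simp only at h1 h2 h3 h4
    rw [Metric.mem_ball, Prod.dist_eq, Real.dist_eq, Real.dist_eq]
    refine max_lt ?_ ?_ <;> rw [abs_lt] <;> constructor <;> simp <;> linarith
  have hsub := hball.trans hz
  rw [← ball_prod_same] at hsub
  refine (hpos _ (hTK _ z.2)).mono ?_ ?_ ?_
  · exact singleton_subset_iff.2 ⟨_, z.2, rfl⟩
  · exact fun σ hσ => ⟨hss hσ, (hsub (mk_mem_prod hσ ⟨le_rfl, ht⟩)).1⟩
  · exact fun τ hτ => ⟨htt hτ, (hsub (mk_mem_prod ⟨le_rfl, hs⟩ hτ)).2⟩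

end LocalIncidence

/-! ### Arrows of segments of curves -/

noncomputable section

section Segments

/-- A finite set containing `a` and `b` subdivides `[a, b]` into intervals without interior points in
this set. -/
theorem piecewiseOn_of_finite {T : Set ℝ} (hT : T.Finite) {a b : ℝ} (ha : a ∈ T) (hb : b ∈ T)
    (hab : a < b) : PiecewiseOn (fun s t => s ∈ T ∧ t ∈ T ∧ ∀ u ∈ T, u ∉ Ioo s t) a b := by
  induction h : (T ∩ Ioo a b).ncard using Nat.strong_induction_on generalizing a b with
  | _ n ih =>
    subst h
    by_cases h : ∃ u ∈ T, u ∈ Ioo a b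
    · obtain ⟨u, hu, hau, hub⟩ := h
      have hfin : (T ∩ Ioo a b).Finite := hT.inter_of_left _
      refine PiecewiseOn.trans (ih _ ?_ ha hu hau rfl) (ih _ ?_ hu hb hub rfl)
      · refine ncard_lt_ncard ⟨?_, fun hc => ?_⟩ hfin
        · exact inter_subset_inter_right _ (Ioo_subset_Ioo_right hub.le)
        · exact lt_irrefl _ (hc ⟨hu, hau, hub⟩).2.2
      · refine ncard_lt_ncard ⟨?_, fun hc => ?_⟩ hfin
        · exact inter_subset_inter_right _ (Ioo_subset_Ioo_left hau.le)
        · exact lt_irrefl _ (hc ⟨hu, hau, hub⟩).2.1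
    · push Not at h
      exact PiecewiseOn.single hab ⟨ha, hb, h⟩

theorem isReparametrization_affine_two {φ : ℝ → ℝ} {c k l k' l' : ℝ} (hc0 : 0 < c) (hc1 : c < 1)
    (hk : 0 < k) (hk' : 0 < k') (h0 : φ 0 = 0) (h1 : φ 1 = 1)
    (h : ∀ t ∈ Icc 0 c, φ t = k * t + l) (h' : ∀ t ∈ Icc c 1, φ t = k' * t + l') :
    IsReparametrization φ := by
  have key : ∀ k l a b : ℝ, a < b → 0 < k → (∀ t ∈ Icc a b, φ t = k * t + l) →
      PiecewiseOn (fun a b => AnalyticOn ℝ φ (Icc a b) ∧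
        ∀ t ∈ Icc a b, 0 < derivWithin φ (Icc a b) t) a b := by
    intro k l a b hab hk h
    refine PiecewiseOn.single hab ⟨?_, fun t ht => ?_⟩
    · exact ((analyticOn_const.mul analyticOn_id).add analyticOn_const).congr h
    · have h1 : HasDerivWithinAt (fun t : ℝ => k * t + l) k (Icc a b) t := by
        simpa using (((hasDerivAt_id t).const_mul k).add_const l).hasDerivWithinAt
      rw [(h1.congr h (h t ht)).derivWithin (uniqueDiffOn_Icc hab t ht)]
      exact hk
  exact ⟨h0, h1, (key _ _ _ _ hc0 hk h).trans (key _ _ _ _ hc1 hk' h')⟩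

theorem isReparametrization_id : IsReparametrization (fun t => t) :=
  isReparametrization_affine_two (c := 1 / 2) (k := 1) (k' := 1) (l := 0) (l' := 0) (by norm_num)
    (by norm_num) one_pos one_pos rfl rfl (by simp) (by simp)

variable {d : ℕ} {M : Type*} [TopologicalSpace M] [ChartedSpace (EuclideanSpace ℝ (Fin d)) M]

theorem IsAnalyticArc.mono {f : ℝ → M} {a b s t : ℝ} (h : IsAnalyticArc d f a b) (has : a ≤ s)
    (hst : s < t) (htb : t ≤ b) : IsAnalyticArc d f s t :=
  h.comp_affine 1 0 one_ne_zero hst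
    (fun u hu => ⟨by linarith [hu.1], by linarith [hu.2]⟩)
    (fun u hu => ⟨by linarith [hu.1], by linarith [hu.2]⟩) (fun u _ => by simp)

/-- The path that runs through `f` on `[s, t]` at constant speed. -/
def segmentPath {f : ℝ → M} {s t : ℝ} (hst : s ≤ t) (hf : ContinuousOn f (Icc s t)) :
    Path (f s) (f t) where
  toFun u := f ((t - s) * u + s)
  continuous_toFun := by
    refine hf.comp_continuous (by fun_prop) fun u => ?_
    have h0 := u.2.1
    have h1 := u.2.2
    constructor <;> nlinarith
  source' := by simp
  target' := by simp

/-- The curve that runs through `f` on `[s, t]` at constant speed. -/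
def Curve.segment {f : ℝ → M} {s t : ℝ} (hf : ContinuousOn f (Icc s t))
    (h : PiecewiseOn (IsPiece d f) s t) : Curve d (f s) (f t) where
  path := segmentPath h.lt.le hf
  piecewise := by
    have hst := h.lt
    have hpos : 0 < t - s := sub_pos.2 hst
    have := PiecewiseOn.affine (Q := IsPiece d (segmentPath h.lt.le hf).extend) (t - s)⁻¹
      (-(t - s)⁻¹ * s) (inv_pos.2 hpos) h ?_
    · convert this using 1
      · ring
      · linear_combination -(mul_inv_cancel₀ hpos.ne')
    · intro a b hsa hab hbt hp
      have hinv : (t - s) * (t - s)⁻¹ = 1 := mul_inv_cancel₀ hpos.ne'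
      have e : ∀ v, (t - s) * ((t - s)⁻¹ * v + -(t - s)⁻¹ * s) + s = v := fun v => by
        linear_combination (v - s) * hinv
      have hle : ∀ v w, (t - s)⁻¹ * v + -(t - s)⁻¹ * s ≤ w → v ≤ (t - s) * w + s := by
        intro v w hvw
        have := mul_le_mul_of_nonneg_left hvw hpos.le
        linarith [e v]
      have hle' : ∀ v w, w ≤ (t - s)⁻¹ * v + -(t - s)⁻¹ * s → (t - s) * w + s ≤ v := by
        intro v w hvw
        have := mul_le_mul_of_nonneg_left hvw hpos.le
        linarith [e v]
      have hlt : ∀ v w, (t - s)⁻¹ * v + -(t - s)⁻¹ * s < w → v < (t - s) * w + s := by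
        intro v w hvw
        have := mul_lt_mul_of_pos_left hvw hpos
        linarith [e v]
      have hlt' : ∀ v w, w < (t - s)⁻¹ * v + -(t - s)⁻¹ * s → (t - s) * w + s < v := by
        intro v w hvw
        have := mul_lt_mul_of_pos_left hvw hpos
        linarith [e v]
      refine hp.comp_affine (t - s) s hpos.ne' ?_ (fun u hu => ⟨hle _ _ hu.1, hle' _ _ hu.2⟩)
        (fun u hu => ⟨hlt _ _ hu.1, hlt' _ _ hu.2⟩) (fun u hu => ?_)
      · have := mul_lt_mul_of_pos_left hab (inv_pos.2 hpos)
        linarith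
      · have h1 := hle _ _ hu.1
        have h2 := hle' _ _ hu.2
        have hu0 : 0 ≤ u := by
          by_contra hc
          push Not at hc
          nlinarith
        have hu1 : u ≤ 1 := by
          by_contra hc
          push Not at hc
          nlinarith
        rw [Path.extend_apply _ ⟨hu0, hu1⟩]
        rfl

theorem Curve.segment_extend {f : ℝ → M} {s t : ℝ} (hf : ContinuousOn f (Icc s t))
    (h : PiecewiseOn (IsPiece d f) s t) {u : ℝ} (hu : u ∈ Icc (0 : ℝ) 1) :
    (Curve.segment hf h).path.extend u = f ((t - s) * u + s) :=
  Path.extend_apply _ hu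

/-- The arrow of a curve does not depend on the parametrization. As end points are recovered from
the curves only up to propositional equality, this is expressed by means of a predicate on arrows. -/
theorem Curve.toHom_of_reparam (Pr : ∀ ⦃x y : PathGroupoid d M⦄, (x ⟶ y) → Prop) {x y x' y' : M}
    {c : Curve d x y} {c' : Curve d x' y'} {φ : ℝ → ℝ} (hφ : IsReparametrization φ)
    (h : ∀ t ∈ Icc (0 : ℝ) 1, c'.path.extend t = c.path.extend (φ t)) :
    Pr c.toHom ↔ Pr c'.toHom := by
  have hx : x' = x := by
    have := h 0 (by simp)
    rwa [hφ.map_zero, Path.extend_zero, Path.extend_zero] at this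
  have hy : y' = y := by
    have := h 1 (by simp)
    rwa [hφ.map_one, Path.extend_one, Path.extend_one] at this
  subst hx hy
  have : c.toHom = c'.toHom := Quotient.sound (CurveEquiv.reparam φ hφ h)
  rw [this]

/-- `f` is a curve on `[s, t]` and its arrow satisfies `Pr`. -/
def SegmentSatisfies (Pr : ∀ ⦃x y : PathGroupoid d M⦄, (x ⟶ y) → Prop) (f : ℝ → M) (s t : ℝ) :
    Prop :=
  ∃ (hf : ContinuousOn f (Icc s t)) (h : PiecewiseOn (IsPiece d f) s t),
    Pr (Curve.segment hf h).toHom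

theorem SegmentSatisfies.trans {Pr : ∀ ⦃x y : PathGroupoid d M⦄, (x ⟶ y) → Prop}
    (hPr : ∀ ⦃x y z : PathGroupoid d M⦄ (p : x ⟶ y) (q : y ⟶ z), Pr p → Pr q → Pr (p ≫ q))
    {f : ℝ → M} {r s t : ℝ} (h₁ : SegmentSatisfies Pr f r s) (h₂ : SegmentSatisfies Pr f s t) :
    SegmentSatisfies Pr f r t := by
  obtain ⟨hf₁, hp₁, h₁⟩ := h₁
  obtain ⟨hf₂, hp₂, h₂⟩ := h₂
  have hrs := hp₁.lt
  have hst := hp₂.lt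
  have hf : ContinuousOn f (Icc r t) := by
    rw [← Icc_union_Icc_eq_Icc hrs.le hst.le]
    exact hf₁.union_of_isClosed hf₂ isClosed_Icc isClosed_Icc
  refine ⟨hf, PiecewiseOn.trans hp₁ hp₂, ?_⟩
  have h := hPr _ _ h₁ h₂
  have hrt : 0 < t - r := by linarith
  refine (Curve.toHom_of_reparam Pr (c' := (Curve.segment hf₁ hp₁).trans (Curve.segment hf₂ hp₂))
    (φ := fun u => if u ≤ 1 / 2 then 2 * (s - r) / (t - r) * u + 0
      else 2 * (t - s) / (t - r) * u + ((s - r) - (t - s)) / (t - r)) ?_ ?_).2 h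
  · refine isReparametrization_affine_two (c := 1 / 2) (k := 2 * (s - r) / (t - r)) (l := 0)
      (k' := 2 * (t - s) / (t - r)) (l' := ((s - r) - (t - s)) / (t - r)) (by norm_num)
      (by norm_num) (div_pos (by linarith) hrt) (div_pos (by linarith) hrt) (by norm_num) ?_
      (fun u hu => if_pos hu.2) (fun u hu => ?_)
    · rw [if_neg (by norm_num)]
      field_simp
      ring
    · split_ifs with hc
      · have : u = 1 / 2 := le_antisymm hc hu.1
        rw [this]
        field_simp
        ring
      · rfl
  · intro u hu
    change ((Curve.segment hf₁ hp₁).path.trans (Curve.segment hf₂ hp₂).path).extend u = _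
    split_ifs with hc
    · have h0 : 2 * (s - r) / (t - r) * u + 0 ∈ Icc (0 : ℝ) 1 := by
        constructor
        · have := hu.1
          have : 0 ≤ 2 * (s - r) / (t - r) := div_nonneg (by linarith) hrt.le
          positivity
        · rw [add_zero, div_mul_eq_mul_div, div_le_one hrt]
          nlinarith
      rw [Path.extend_trans_of_le_half _ _ hc, Curve.segment_extend _ _ h0,
        Curve.segment_extend _ _ ⟨by linarith [hu.1], by linarith⟩]
      congr 1
      field_simp
      ring
    · push Not at hc
      have h0 : 2 * (t - s) / (t - r) * u + ((s - r) - (t - s)) / (t - r) ∈ Icc (0 : ℝ) 1 := by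
        rw [div_mul_eq_mul_div, ← add_div]
        constructor
        · apply div_nonneg _ hrt.le
          nlinarith
        · rw [div_le_one hrt]
          nlinarith [hu.2]
      rw [Path.extend_trans_of_half_le _ _ hc.le, Curve.segment_extend _ _ h0,
        Curve.segment_extend _ _ ⟨by linarith, by linarith [hu.2]⟩]
      congr 1
      field_simp
      ring

theorem SegmentSatisfies.of_piecewiseOn {Pr : ∀ ⦃x y : PathGroupoid d M⦄, (x ⟶ y) → Prop}
    (hPr : ∀ ⦃x y z : PathGroupoid d M⦄ (p : x ⟶ y) (q : y ⟶ z), Pr p → Pr q → Pr (p ≫ q))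
    {f : ℝ → M} {a b : ℝ} {Q : ℝ → ℝ → Prop} (h : PiecewiseOn Q a b)
    (hQ : ∀ s t, a ≤ s → s < t → t ≤ b → Q s t → SegmentSatisfies Pr f s t) :
    SegmentSatisfies Pr f a b := by
  induction h with
  | single h => exact hQ _ _ le_rfl h.1 le_rfl h.2
  | tail h₁ h ih =>
    refine SegmentSatisfies.trans hPr (ih fun s t hs hst ht => hQ s t hs hst (ht.trans h.1.le)) ?_
    exact hQ _ _ (PiecewiseOn.lt h₁).le h.1 le_rfl h.2

theorem Curve.toHom_of_segmentSatisfies {Pr : ∀ ⦃x y : PathGroupoid d M⦄, (x ⟶ y) → Prop}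
    {x y : M} (c : Curve d x y) (h : SegmentSatisfies Pr c.path.extend 0 1) : Pr c.toHom := by
  obtain ⟨hf, hp, h⟩ := h
  refine (Curve.toHom_of_reparam Pr isReparametrization_id fun t ht => ?_).1 h
  rw [Curve.segment_extend _ _ ht]
  congr 1
  ring

/-- The analytic curve that runs through an analytic arc on `[a, b]` at constant speed. -/
def AnalyticCurve.ofArc {f : ℝ → M} {a b : ℝ} (hab : a < b) (h : IsAnalyticArc d f a b) :
    AnalyticCurve d M where
  source := f a
  target := f b
  curve := Curve.segment h.analytic.continuousOn (PiecewiseOn.single hab (Or.inl h))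
  isAnalyticArc := h.comp_affine (b - a) a (sub_pos.2 hab).ne' one_pos
    (fun u hu => ⟨by nlinarith [hu.1], by nlinarith [hu.2]⟩)
    (fun u hu => ⟨by nlinarith [hu.1], by nlinarith [hu.2]⟩)
    (fun u hu => Curve.segment_extend _ _ hu)

theorem AnalyticCurve.ofArc_extend {f : ℝ → M} {a b : ℝ} (hab : a < b)
    (h : IsAnalyticArc d f a b) {u : ℝ} (hu : u ∈ Icc (0 : ℝ) 1) :
    (AnalyticCurve.ofArc hab h).curve.path.extend u = f ((b - a) * u + a) :=
  Curve.segment_extend h.analytic.continuousOn (PiecewiseOn.single hab (Or.inl h)) hu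

theorem AnalyticCurve.image_ofArc_subset {f : ℝ → M} {a b : ℝ} (hab : a < b)
    (h : IsAnalyticArc d f a b) : (AnalyticCurve.ofArc hab h).image ⊆ f '' Icc a b := by
  rintro _ ⟨u, rfl⟩
  have h0 := u.2.1
  have h1 := u.2.2
  exact ⟨(b - a) * u + a, ⟨by nlinarith, by nlinarith⟩, rfl⟩

theorem SegmentSatisfies.of_edge {Pr : ∀ ⦃x y : PathGroupoid d M⦄, (x ⟶ y) → Prop}
    {f : ℝ → M} {a b : ℝ} (hab : a < b) (h : IsAnalyticArc d f a b)
    (hPr : Pr (AnalyticCurve.ofArc hab h).edge) : SegmentSatisfies Pr f a b :=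
  ⟨h.analytic.continuousOn, PiecewiseOn.single hab (Or.inl h), hPr⟩

end Segments

end

/-! ### Independent refinements of families of edges -/

noncomputable section

section Refinement

/-- Let `P` be a set of points that contains the end points of two arcs in local position, as well as
`F`, but no interior point of the arcs. Then the interiors of the arcs are disjoint, or the arcs agree
up to an analytic change of parameter, which may reverse the orientation. -/
theorem LocalPosition.disjoint_or_eq {M : Type*} {F P : Set M} {f f' : ℝ → M} {s s' t t' : ℝ}
    (h : LocalPosition F f f' (Icc s s') (Icc t t')) (hst : s < s') (htt : t < t') (hFP : F ⊆ P)
    (hfP : ∀ σ ∈ Ioo s s', f σ ∉ P) (hf'P : ∀ τ ∈ Ioo t t', f' τ ∉ P)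
    (hs : f s ∈ P) (hs' : f s' ∈ P) (ht : f' t ∈ P) (ht' : f' t' ∈ P) :
    Disjoint (f '' Ioo s s') (f' '' Ioo t t') ∨
    ∃ φ : ℝ → ℝ, (∀ τ ∈ Icc t t', AnalyticAt ℝ φ τ) ∧ (∀ τ ∈ Icc t t', φ τ ∈ Icc s s') ∧
      (∀ τ ∈ Icc t t', f' τ = f (φ τ)) ∧
      ((φ t = s ∧ φ t' = s' ∧ ∀ τ ∈ Icc t t', 0 < deriv φ τ) ∨
        (φ t = s' ∧ φ t' = s ∧ ∀ τ ∈ Icc t t', deriv φ τ < 0)) := by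
  by_cases hd : Disjoint (f '' Ioo s s') (f' '' Ioo t t')
  · exact Or.inl hd
  right
  obtain ⟨_, ⟨σ₀, hσ₀, rfl⟩, ⟨τ₀, hτ₀, e₀⟩⟩ := Set.not_disjoint_iff.1 hd
  rcases h with h | ⟨φ, hφ, h⟩
  · exact (hfP σ₀ hσ₀ (hFP (h _ (Ioo_subset_Icc_self hσ₀) _ (Ioo_subset_Icc_self hτ₀)
      e₀.symm))).elim
  have hcont : ContinuousOn φ (Icc t t') := fun τ hτ =>
    (hφ τ hτ).1.continuousAt.continuousWithinAt
  -- the interior parameters that `φ` maps to interior ones form a clopen subset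
  have hW : Ioo t t' ⊆ Ioo t t' ∩ φ ⁻¹' Ioo s s' := by
    refine isPreconnected_Ioo.subset_of_closure_inter_subset
      ((hcont.mono Ioo_subset_Icc_self).isOpen_inter_preimage isOpen_Ioo isOpen_Ioo)
      ⟨τ₀, hτ₀, hτ₀, ?_⟩ ?_
    · rw [mem_preimage, ← (h _ (Ioo_subset_Icc_self hσ₀) _ (Ioo_subset_Icc_self hτ₀)).1 e₀.symm]
      exact hσ₀
    · rintro τ ⟨hcl, hτ⟩
      have h1 : φ τ ∈ closure (Ioo s s') :=
        ContinuousWithinAt.mem_closure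
          ((hφ τ (Ioo_subset_Icc_self hτ)).1.continuousAt.continuousWithinAt) hcl fun _ hx => hx.2
      rw [closure_Ioo hst.ne] at h1
      have h2 := (h _ h1 _ (Ioo_subset_Icc_self hτ)).2 rfl
      have h3 := hf'P τ hτ
      rw [← h2] at h3
      refine ⟨hτ, lt_of_le_of_ne h1.1 ?_, lt_of_le_of_ne h1.2 ?_⟩
      · intro hc
        exact h3 (hc ▸ hs)
      · intro hc
        exact h3 (hc ▸ hs')
  have hmap : ∀ τ ∈ Icc t t', φ τ ∈ Icc s s' := by
    intro τ hτ
    have h1 : φ τ ∈ closure (Ioo s s') :=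
      ContinuousWithinAt.mem_closure (s := Ioo t t')
        ((hφ τ hτ).1.continuousAt.continuousWithinAt) (by rwa [closure_Ioo htt.ne])
        fun _ hx => (hW hx).2
    rwa [closure_Ioo hst.ne] at h1
  have heq : ∀ τ ∈ Icc t t', f' τ = f (φ τ) := fun τ hτ => ((h _ (hmap τ hτ) _ hτ).2 rfl).symm
  have hend : ∀ τ ∈ Icc t t', f' τ ∈ P → φ τ = s ∨ φ τ = s' := by
    intro τ hτ hP
    rw [heq τ hτ] at hP
    have h1 := hmap τ hτ
    by_contra! hc
    exact hfP _ ⟨lt_of_le_of_ne h1.1 hc.1.symm, lt_of_le_of_ne h1.2 hc.2⟩ hP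
  have htm : t ∈ Icc t t' := ⟨le_rfl, htt.le⟩
  have htm' : t' ∈ Icc t t' := ⟨htt.le, le_rfl⟩
  refine ⟨φ, fun τ hτ => (hφ τ hτ).1, hmap, heq, ?_⟩
  rcases hasDerivWithinAt_forall_lt_or_forall_gt_of_forall_ne (convex_Icc t t')
    (fun τ hτ => (hφ τ hτ).1.differentiableAt.hasDerivAt.hasDerivWithinAt)
    (fun τ hτ => (hφ τ hτ).2) with hneg | hpos
  · right
    have hanti := (strictAntiOn_of_deriv_neg (convex_Icc t t') hcont fun τ hτ =>
      hneg τ (interior_subset hτ)) htm htm' htt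
    have h1 := hmap t htm
    have h2 := hmap t' htm'
    refine ⟨(hend t htm ht).resolve_left ?_, (hend t' htm' ht').resolve_right ?_, hneg⟩
    · intro hc
      linarith [h2.1]
    · intro hc
      linarith [h1.2]
  · left
    have hmono := (strictMonoOn_of_deriv_pos (convex_Icc t t') hcont fun τ hτ =>
      hpos τ (interior_subset hτ)) htm htm' htt
    have h1 := hmap t htm
    have h2 := hmap t' htm'
    refine ⟨(hend t htm ht).resolve_right ?_, (hend t' htm' ht').resolve_left ?_, hpos⟩
    · intro hc
      linarith [h2.2]
    · intro hc
      linarith [h1.1]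

theorem isReparametrization_of_analyticAt {φ : ℝ → ℝ} {t t' k l : ℝ} (htt : t < t')
    (hφ : ∀ τ ∈ Icc t t', AnalyticAt ℝ φ τ) (hk : ∀ τ ∈ Icc t t', 0 < k * deriv φ τ)
    (h0 : k * φ t + l = 0) (h1 : k * φ t' + l = 1) :
    IsReparametrization fun u => k * φ ((t' - t) * u + t) + l := by
  refine ⟨by simpa using h0, by simpa using h1, PiecewiseOn.single zero_lt_one ?_⟩
  have hm : ∀ u ∈ Icc (0 : ℝ) 1, (t' - t) * u + t ∈ Icc t t' := fun u hu =>
    ⟨by nlinarith [hu.1], by nlinarith [hu.2]⟩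
  have ha : AnalyticOn ℝ (fun u : ℝ => (t' - t) * u + t) (Icc 0 1) :=
    (analyticOn_const.mul analyticOn_id).add analyticOn_const
  have hφ' : AnalyticOn ℝ φ (Icc t t') := fun τ hτ => (hφ τ hτ).analyticWithinAt
  refine ⟨(analyticOn_const.mul (hφ'.comp ha hm)).add analyticOn_const, fun u hu => ?_⟩
  have d1 : HasDerivAt (fun u : ℝ => (t' - t) * u + t) (t' - t) u := by
    simpa using ((hasDerivAt_id u).const_mul (t' - t)).add_const t
  have d2 : HasDerivAt φ (deriv φ ((t' - t) * u + t)) ((t' - t) * u + t) :=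
    (hφ _ (hm u hu)).differentiableAt.hasDerivAt
  have d3 := ((d2.comp u d1).const_mul k).add_const l
  have d4 := d3.hasDerivWithinAt.derivWithin (uniqueDiffOn_Icc zero_lt_one u hu)
  refine lt_of_lt_of_eq ?_ d4.symm
  have := mul_pos (hk _ (hm u hu)) (sub_pos.2 htt)
  linarith

variable {d : ℕ} {M : Type*} [TopologicalSpace M] [ChartedSpace (EuclideanSpace ℝ (Fin d)) M]

/-- An arc that is a reparametrization of another one, up to orientation, lies in every subgroupoid
that contains the latter. -/
theorem edge_ofArc_mem_of_eq_comp (S : Subgroupoid (PathGroupoid d M)) {f f' : ℝ → M}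
    {s s' t t' : ℝ} (hst : s < s') (htt : t < t') (h : IsAnalyticArc d f s s')
    (h' : IsAnalyticArc d f' t t') {φ : ℝ → ℝ} (hφ : ∀ τ ∈ Icc t t', AnalyticAt ℝ φ τ)
    (hmap : ∀ τ ∈ Icc t t', φ τ ∈ Icc s s') (heq : ∀ τ ∈ Icc t t', f' τ = f (φ τ))
    (hend : (φ t = s ∧ φ t' = s' ∧ ∀ τ ∈ Icc t t', 0 < deriv φ τ) ∨
        (φ t = s' ∧ φ t' = s ∧ ∀ τ ∈ Icc t t', deriv φ τ < 0))
    (hS : (AnalyticCurve.ofArc hst h).edge ∈ S.arrows _ _) :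
    (AnalyticCurve.ofArc htt h').edge ∈ S.arrows _ _ := by
  have hpos : 0 < s' - s := sub_pos.2 hst
  have hinv : (s' - s)⁻¹ * (s' - s) = 1 := inv_mul_cancel₀ hpos.ne'
  have hinv' := inv_pos.2 hpos
  have hm : ∀ u ∈ Icc (0 : ℝ) 1, (t' - t) * u + t ∈ Icc t t' := fun u hu =>
    ⟨by nlinarith [hu.1], by nlinarith [hu.2]⟩
  have hext' : ∀ u ∈ Icc (0 : ℝ) 1, (AnalyticCurve.ofArc htt h').curve.path.extend u =
      f (φ ((t' - t) * u + t)) := fun u hu => by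
    rw [← heq _ (hm u hu)]
    exact AnalyticCurve.ofArc_extend htt h' hu
  rcases hend with ⟨h0, h1, hd⟩ | ⟨h0, h1, hd⟩
  · refine (Curve.toHom_of_reparam (fun x y p => p ∈ S.arrows x y)
      (isReparametrization_of_analyticAt (k := (s' - s)⁻¹) (l := -(s' - s)⁻¹ * s) htt hφ
      (fun τ hτ => mul_pos hinv' (hd τ hτ)) (by rw [h0]; ring)
      (by rw [h1]; linear_combination hinv)) fun u hu => ?_).1 hS
    have hu' : (s' - s)⁻¹ * φ ((t' - t) * u + t) + -(s' - s)⁻¹ * s ∈ Icc (0 : ℝ) 1 := by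
      obtain ⟨h2, h3⟩ := hmap _ (hm u hu)
      constructor
      · have := mul_le_mul_of_nonneg_left h2 hinv'.le
        linarith
      · have := mul_le_mul_of_nonneg_left h3 hinv'.le
        linarith
    rw [hext' u hu]
    refine Eq.trans ?_ (AnalyticCurve.ofArc_extend hst h hu').symm
    congr 1
    linear_combination (s - φ ((t' - t) * u + t)) * hinv
  · have hS' : (AnalyticCurve.ofArc hst h).curve.symm.toHom ∈ S.arrows (f s') (f s) := S.inv hS
    refine (Curve.toHom_of_reparam (fun x y p => p ∈ S.arrows x y)
      (isReparametrization_of_analyticAt (k := -(s' - s)⁻¹) (l := (s' - s)⁻¹ * s') htt hφ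
      (fun τ hτ => by have := mul_pos hinv' (neg_pos.2 (hd τ hτ)); linarith) (by rw [h0]; ring)
      (by rw [h1]; linear_combination hinv)) fun u hu => ?_).1 hS'
    have hu' : 1 - (-(s' - s)⁻¹ * φ ((t' - t) * u + t) + (s' - s)⁻¹ * s') ∈ Icc (0 : ℝ) 1 := by
      obtain ⟨h2, h3⟩ := hmap _ (hm u hu)
      constructor
      · have := mul_le_mul_of_nonneg_left h2 hinv'.le
        linarith
      · have := mul_le_mul_of_nonneg_left h3 hinv'.le
        linarith
    rw [hext' u hu]
    change _ = (AnalyticCurve.ofArc hst h).curve.path.symm.extend _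
    rw [Path.extend_symm_apply]
    refine Eq.trans ?_ (AnalyticCurve.ofArc_extend hst h hu').symm
    congr 1
    linear_combination (s' - φ ((t' - t) * u + t)) * hinv

theorem IsAnalyticArc.finite_preimage {f : ℝ → M} {a b : ℝ} (h : IsAnalyticArc d f a b)
    {P : Set M} (hP : P.Finite) : (Icc a b ∩ f ⁻¹' P).Finite := by
  have hinj : InjOn f (Ioo a b) := fun s hs t ht e =>
    congrArg Subtype.val (h.embedding.injective (a₁ := ⟨s, hs⟩) (a₂ := ⟨t, ht⟩) e)
  have h1 : (Ioo a b ∩ f ⁻¹' P).Finite := by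
    refine Finite.of_finite_image (f := f) (hP.subset ?_) (hinj.mono inter_subset_left)
    rintro _ ⟨x, hx, rfl⟩
    exact hx.2
  refine (h1.union (toFinite {a, b})).subset ?_
  rintro x ⟨hx, hxP⟩
  by_cases hxa : x = a
  · exact Or.inr (Or.inl hxa)
  by_cases hxb : x = b
  · exact Or.inr (Or.inr hxb)
  exact Or.inl ⟨⟨lt_of_le_of_ne hx.1 (Ne.symm hxa), lt_of_le_of_ne hx.2 hxb⟩, hxP⟩

/-- Every finite family of edges lies in the subgroupoid generated by an independent family. -/
theorem exists_independent_refinement [T2Space M] [IsManifold (𝓡 d) ω M] {n : ℕ}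
    (c : Fin n → AnalyticCurve d M) :
    ∃ (m : ℕ) (e : Fin m → AnalyticCurve d M), Independent e ∧
      ∀ i, (c i).edge ∈ (edgeSubgroupoid e).arrows _ _ := by
  let f : Fin n → ℝ → M := fun i => (c i).curve.path.extend
  have hf : ∀ i, IsAnalyticArc d (f i) 0 1 := fun i => (c i).isAnalyticArc
  choose F hF δ hδ hpos using fun i j =>
    (hf i).exists_finite_localPosition (hf j) zero_lt_one zero_lt_one
  obtain ⟨N, hN⟩ : ∃ N : ℕ, ∀ i j, 1 / ((N : ℝ) + 1) < δ i j := by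
    have : ∀ᶠ N : ℕ in Filter.atTop, ∀ i j, 1 / ((N : ℝ) + 1) < δ i j :=
      Filter.eventually_all.2 fun i => Filter.eventually_all.2 fun j =>
        tendsto_one_div_add_atTop_nhds_zero_nat.eventually_lt_const (hδ i j)
    exact this.exists
  have hN0 : (0 : ℝ) < N + 1 := by positivity
  -- every incidence that is not on the graph of a change of parameter is in `P`, and cutting at `P`
  -- yields pieces of length at most `1 / (N + 1)`
  let P : Set M := (⋃ i, ⋃ j, F i j) ∪
    range fun z : Fin n × Fin (N + 2) => f z.1 ((z.2 : ℕ) / ((N : ℝ) + 1))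
  have hP : P.Finite :=
    (finite_iUnion fun i => finite_iUnion fun j => hF i j).union (finite_range _)
  have hFP : ∀ i j, F i j ⊆ P := fun i j =>
    (subset_iUnion_of_subset i (subset_iUnion (F i) j)).trans subset_union_left
  have hfP : ∀ i (k : ℕ), k ≤ N + 1 → f i (k / ((N : ℝ) + 1)) ∈ P := fun i k hk =>
    Or.inr ⟨(i, ⟨k, by omega⟩), rfl⟩
  have hfP0 : ∀ i, f i 0 ∈ P := fun i => by simpa using hfP i 0 (by omega)
  have hfP1 : ∀ i, f i 1 ∈ P := fun i => by
    have := hfP i (N + 1) le_rfl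
    push_cast at this
    rwa [div_self hN0.ne'] at this
  let T : Fin n → Set ℝ := fun i => Icc 0 1 ∩ f i ⁻¹' P
  have hT : ∀ i, (T i).Finite := fun i => (hf i).finite_preimage hP
  -- the pieces between consecutive cut points
  let K : Set (Fin n × ℝ × ℝ) := {κ | κ.2.1 < κ.2.2 ∧ κ.2.1 ∈ T κ.1 ∧ κ.2.2 ∈ T κ.1 ∧
    ∀ u ∈ T κ.1, u ∉ Ioo κ.2.1 κ.2.2}
  have hK : K.Finite := by
    have hU : (⋃ i, T i).Finite := finite_iUnion hT
    refine (finite_univ.prod (hU.prod hU)).subset fun κ hκ => ⟨trivial, ?_, ?_⟩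
    · exact mem_iUnion.2 ⟨_, hκ.2.1⟩
    · exact mem_iUnion.2 ⟨_, hκ.2.2.1⟩
  have hKsub : ∀ κ ∈ K, Icc κ.2.1 κ.2.2 ⊆ Icc 0 1 := fun κ hκ =>
    Icc_subset_Icc hκ.2.1.1.1 hκ.2.2.1.1.2
  have hKP : ∀ κ ∈ K, ∀ u ∈ Ioo κ.2.1 κ.2.2, f κ.1 u ∉ P := fun κ hκ u hu hc =>
    hκ.2.2.2 u ⟨hKsub κ hκ (Ioo_subset_Icc_self hu), hc⟩ hu
  have hKδ : ∀ κ ∈ K, ∀ i j, κ.2.2 - κ.2.1 < δ i j := by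
    intro κ hκ i j
    refine lt_of_le_of_lt ?_ (hN i j)
    by_contra! hc
    have h0 : 0 ≤ κ.2.1 := hκ.2.1.1.1
    have h1 : κ.2.2 ≤ 1 := hκ.2.2.1.1.2
    -- the first multiple of `1 / (N + 1)` after the start of the piece
    let k := ⌊κ.2.1 * (N + 1)⌋₊ + 1
    have hk1 : κ.2.1 < k / ((N : ℝ) + 1) := by
      rw [lt_div_iff₀ hN0]
      simpa [k] using Nat.lt_floor_add_one (κ.2.1 * ((N : ℝ) + 1))
    have hk2 : k / ((N : ℝ) + 1) < κ.2.2 := by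
      have h2 : (⌊κ.2.1 * ((N : ℝ) + 1)⌋₊ : ℝ) ≤ κ.2.1 * (N + 1) :=
        Nat.floor_le (mul_nonneg h0 hN0.le)
      have h3 : k / ((N : ℝ) + 1) ≤ κ.2.1 + 1 / ((N : ℝ) + 1) := by
        rw [div_le_iff₀ hN0, add_mul, one_div_mul_cancel hN0.ne']
        simpa [k] using h2
      linarith
    have hk3 : k ≤ N + 1 := by
      have : (k : ℝ) < N + 1 := (div_lt_one hN0).1 (hk2.trans_le h1)
      exact_mod_cast this.le
    exact hKP κ hκ _ ⟨hk1, hk2⟩ (hfP κ.1 k hk3)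
  have harc : ∀ κ ∈ K, IsAnalyticArc d (f κ.1) κ.2.1 κ.2.2 := fun κ hκ =>
    (hf κ.1).mono hκ.2.1.1.1 hκ.1 hκ.2.2.1.1.2
  let O : Fin n × ℝ × ℝ → Set M := fun κ => f κ.1 '' Ioo κ.2.1 κ.2.2
  -- a maximal set of pieces with pairwise disjoint interiors
  obtain ⟨R, hRmax⟩ : ∃ R, Maximal (fun R => R ⊆ K ∧ R.PairwiseDisjoint O) R := by
    have hfin : {R | R ⊆ K ∧ R.PairwiseDisjoint O}.Finite :=
      hK.finite_subsets.subset fun R hR => hR.1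
    exact hfin.exists_maximal ⟨∅, empty_subset _, pairwiseDisjoint_empty⟩
  have hRK := hRmax.prop.1
  have hRfin : R.Finite := hK.subset hRK
  have : Finite R := hRfin
  obtain ⟨m, ⟨ε⟩⟩ := Finite.exists_equiv_fin R
  let e : Fin m → AnalyticCurve d M := fun k =>
    AnalyticCurve.ofArc (hRK (ε.symm k).2).1 (harc _ (hRK (ε.symm k).2))
  refine ⟨m, e, ?_, ?_⟩
  · rintro i j hij x ⟨hxi, hxj⟩
    obtain ⟨σ, hσ, rfl⟩ := AnalyticCurve.image_ofArc_subset _ _ hxi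
    obtain ⟨τ, hτ, hτσ⟩ := AnalyticCurve.image_ofArc_subset _ _ hxj
    have hi := hRK (ε.symm i).2
    have hj := hRK (ε.symm j).2
    by_cases hσ0 : σ = (ε.symm i : Fin n × ℝ × ℝ).2.1
    · exact Or.inl (by rw [hσ0]; rfl)
    by_cases hσ1 : σ = (ε.symm i : Fin n × ℝ × ℝ).2.2
    · exact Or.inr (by rw [hσ1]; rfl)
    exfalso
    have hσ' : σ ∈ Ioo (ε.symm i : Fin n × ℝ × ℝ).2.1 (ε.symm i : Fin n × ℝ × ℝ).2.2 :=
      ⟨lt_of_le_of_ne hσ.1 (Ne.symm hσ0), lt_of_le_of_ne hσ.2 hσ1⟩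
    have hσP := hKP _ hi σ hσ'
    rw [← hτσ] at hσP
    have hτ' : τ ∈ Ioo (ε.symm j : Fin n × ℝ × ℝ).2.1 (ε.symm j : Fin n × ℝ × ℝ).2.2 := by
      refine ⟨lt_of_le_of_ne hτ.1 ?_, lt_of_le_of_ne hτ.2 ?_⟩
      · rintro rfl
        exact hσP hj.2.1.2
      · rintro rfl
        exact hσP hj.2.2.1.2
    have hne : (ε.symm i : Fin n × ℝ × ℝ) ≠ ε.symm j := fun hc =>
      hij (ε.symm.injective (Subtype.ext hc))
    exact Set.disjoint_iff.1 (hRmax.prop.2 (ε.symm i).2 (ε.symm j).2 hne)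
      ⟨⟨σ, hσ', rfl⟩, ⟨τ, hτ', hτσ⟩⟩
  -- every piece is, up to a change of parameter, one of the selected ones
  have hpiece : ∀ κ (hκ : κ ∈ K), (AnalyticCurve.ofArc hκ.1 (harc κ hκ)).edge ∈
      (edgeSubgroupoid e).arrows _ _ := by
    intro κ hκ
    have hgen : ∀ ρ (hρ : ρ ∈ R), (AnalyticCurve.ofArc (hRK hρ).1 (harc ρ (hRK hρ))).edge ∈
        (edgeSubgroupoid e).arrows _ _ := by
      have : ∀ z : R, (AnalyticCurve.ofArc (hRK z.2).1 (harc _ (hRK z.2))).edge ∈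
          (edgeSubgroupoid e).arrows _ _ := ε.symm.surjective.forall.2 fun k => edge_mem e k
      exact fun ρ hρ => this ⟨ρ, hρ⟩
    by_cases hκR : κ ∈ R
    · exact hgen κ hκR
    obtain ⟨ρ, hρ, hρκ⟩ : ∃ ρ ∈ R, ¬ Disjoint (O ρ) (O κ) := by
      by_contra! hc
      refine hκR (hRmax.le_of_ge (y := insert κ R) ⟨insert_subset hκ hRK, ?_⟩
        (subset_insert _ _) (mem_insert _ _))
      exact hRmax.prop.2.insert fun ρ hρ _ => (hc ρ hρ).symm
    have hρK := hRK hρ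
    obtain ⟨φ, h1, h2, h3, h4⟩ := ((hpos ρ.1 κ.1 _ _ _ _ hρK.1.le hκ.1.le (hKsub ρ hρK)
      (hKsub κ hκ) (hKδ ρ hρK _ _) (hKδ κ hκ _ _)).disjoint_or_eq hρK.1 hκ.1 (hFP _ _)
      (hKP ρ hρK) (hKP κ hκ) hρK.2.1.2 hρK.2.2.1.2 hκ.2.1.2 hκ.2.2.1.2).resolve_left hρκ
    exact edge_ofArc_mem_of_eq_comp _ hρK.1 hκ.1 (harc ρ hρK) (harc κ hκ) h1 h2 h3 h4 (hgen ρ hρ)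
  intro i
  refine Curve.toHom_of_segmentSatisfies (Pr := fun x y p => p ∈ (edgeSubgroupoid e).arrows x y)
    (c i).curve ?_
  refine SegmentSatisfies.of_piecewiseOn (fun x y z p q hp hq => Subgroupoid.mul _ hp hq)
    (piecewiseOn_of_finite (hT i) ⟨by simp, hfP0 i⟩ ⟨by simp, hfP1 i⟩ zero_lt_one) ?_
  rintro s t - hst - ⟨hs, ht, hu⟩
  have hκ : (i, s, t) ∈ K := ⟨hst, hs, ht, hu⟩
  exact SegmentSatisfies.of_edge hst (harc _ hκ) (hpiece _ hκ)

end Refinement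

end

/-! ### The topology of spaces of morphisms -/

section HomSpace

namespace GroupoidHom

open Filter Topology

variable {C : Type*} [Groupoid C] {G : Type*} [Group G]

/-- The values of a morphism at all arrows. -/
def evalAll (A : GroupoidHom C G) : (Σ x y : C, x ⟶ y) → G := fun a => A.eval a.2.2

theorem evalAll_injective : Function.Injective (evalAll : GroupoidHom C G → _) := by
  intro A B h
  refine CategoryTheory.Functor.ext (C := C) (D := SingleObj G) (fun _ => rfl) fun x y p => ?_
  have := congrFun h ⟨x, y, p⟩
  simpa [evalAll, eval] using this

/-- The morphism with given values at all arrows. -/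
def ofEval (g : (Σ x y : C, x ⟶ y) → G)
    (hg : ∀ (x y z : C) (p : x ⟶ y) (q : y ⟶ z), g ⟨x, z, p ≫ q⟩ = g ⟨y, z, q⟩ * g ⟨x, y, p⟩) :
    GroupoidHom C G :=
  show C ⥤ SingleObj G from
  { obj := fun _ => SingleObj.star G
    map := fun {x y} p => g ⟨x, y, p⟩
    map_id := fun x => by
      have := hg x x x (𝟙 x) (𝟙 x)
      rw [Category.id_comp] at this
      exact left_eq_mul.1 this
    map_comp := fun {x y z} p q => hg x y z p q }

variable [TopologicalSpace G]

theorem isInducing_evalAll : IsInducing (evalAll : GroupoidHom C G → _) := by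
  constructor
  simp only [instTopologicalSpaceGroupoidHom, Pi.topologicalSpace, induced_iInf, induced_compose,
    iInf_sigma]
  rfl

theorem continuous_eval {x y : C} (p : x ⟶ y) : Continuous fun A : GroupoidHom C G => A.eval p :=
  (continuous_apply (⟨x, y, p⟩ : Σ x y : C, x ⟶ y)).comp isInducing_evalAll.continuous

theorem continuous_comap {D : Type*} [Groupoid D] (F : C ⥤ D) :
    Continuous (comap F : GroupoidHom D G → GroupoidHom C G) :=
  isInducing_evalAll.continuous_iff.2 <| continuous_pi fun a => continuous_eval (F.map a.2.2)

instance [T2Space G] : T2Space (GroupoidHom C G) :=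
  T2Space.of_injective_continuous evalAll_injective isInducing_evalAll.continuous

instance [T2Space G] [CompactSpace G] [IsTopologicalGroup G] : CompactSpace (GroupoidHom C G) := by
  have hrange : range (evalAll : GroupoidHom C G → _) =
      ⋂ (x : C) (y : C) (z : C) (p : x ⟶ y) (q : y ⟶ z),
        {g : (Σ x y : C, x ⟶ y) → G | g ⟨x, z, p ≫ q⟩ = g ⟨y, z, q⟩ * g ⟨x, y, p⟩} := by
    ext g
    simp only [mem_iInter, mem_ofPred_eq]
    constructor
    · rintro ⟨A, rfl⟩ x y z p q
      exact A.eval_comp p q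
    · exact fun hg => ⟨ofEval g hg, rfl⟩
  have hcl : IsClosed (range (evalAll : GroupoidHom C G → _)) := by
    rw [hrange]
    refine isClosed_iInter fun x => isClosed_iInter fun y => isClosed_iInter fun z =>
      isClosed_iInter fun p => isClosed_iInter fun q => isClosed_eq (continuous_apply _) ?_
    exact (continuous_apply _).mul (continuous_apply _)
  exact (Topology.IsClosedEmbedding.mk ⟨isInducing_evalAll, evalAll_injective⟩ hcl).compactSpace

end GroupoidHom

open Classical in
/-- The extension by `1` of a morphism on a subgroupoid to all arrows. -/
noncomputable def extendByOne {C : Type*} [Groupoid C] {G : Type*} [Group G] (S : Subgroupoid C)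
    (A : GroupoidHom S.objs G) (a : Σ x y : C, x ⟶ y) : G :=
  if h : a.2.2 ∈ S.arrows a.1 a.2.1 then
    A.eval (x := ⟨_, S.mem_objs_of_src h⟩) (y := ⟨_, S.mem_objs_of_tgt h⟩) ⟨_, h⟩
  else 1

section ExtendByOne

variable {C : Type*} [Groupoid C] {G : Type*} [Group G] {S : Subgroupoid C}
  (A : GroupoidHom S.objs G)

theorem extendByOne_of_mem {x y : C} {p : x ⟶ y} (h : p ∈ S.arrows x y) :
    extendByOne S A ⟨x, y, p⟩ =
      A.eval (x := ⟨_, S.mem_objs_of_src h⟩) (y := ⟨_, S.mem_objs_of_tgt h⟩) ⟨_, h⟩ :=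
  dif_pos h

theorem extendByOne_id (x : C) : extendByOne S A ⟨x, x, 𝟙 x⟩ = 1 := by
  by_cases h : 𝟙 x ∈ S.arrows x x
  · rw [extendByOne_of_mem A h]
    exact A.eval_id ⟨x, S.mem_objs_of_src h⟩
  · exact dif_neg h

theorem extendByOne_comp {x y z : C} {p : x ⟶ y} {q : y ⟶ z} (hp : p ∈ S.arrows x y)
    (hq : q ∈ S.arrows y z) :
    extendByOne S A ⟨x, z, p ≫ q⟩ = extendByOne S A ⟨y, z, q⟩ * extendByOne S A ⟨x, y, p⟩ := by
  rw [extendByOne_of_mem A (S.mul hp hq), extendByOne_of_mem A hp, extendByOne_of_mem A hq]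
  exact A.eval_comp (x := ⟨_, S.mem_objs_of_src hp⟩) (y := ⟨_, S.mem_objs_of_tgt hp⟩)
    (z := ⟨_, S.mem_objs_of_tgt hq⟩) ⟨p, hp⟩ ⟨q, hq⟩

end ExtendByOne

end HomSpace

/-! ### Directedness of the tame subgroupoids -/

section TameSubgroupoids

variable {d : ℕ} {M : Type*} [TopologicalSpace M] [ChartedSpace (EuclideanSpace ℝ (Fin d)) M]

theorem edgeSubgroupoid_le {n : ℕ} {e : Fin n → AnalyticCurve d M}
    {S : Subgroupoid (PathGroupoid d M)} (h : ∀ i, (e i).edge ∈ S.arrows _ _) :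
    edgeSubgroupoid e ≤ S := by
  refine sInf_le ?_
  rintro x y p ⟨i, hi⟩
  cases hi
  exact h i

instance : Nonempty (TameSubgroupoid d M) :=
  ⟨⟨edgeSubgroupoid Fin.elim0, 0, Fin.elim0, fun i => i.elim0, rfl⟩⟩

instance [T2Space M] [IsManifold (𝓡 d) ω M] : IsDirectedOrder (TameSubgroupoid d M) := by
  constructor
  rintro ⟨_, n, e, -, rfl⟩ ⟨_, n', e', -, rfl⟩
  obtain ⟨m, e'', he'', h⟩ := exists_independent_refinement (Fin.append e e')
  refine ⟨⟨edgeSubgroupoid e'', m, e'', he'', rfl⟩, ?_, ?_⟩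
  · refine edgeSubgroupoid_le fun i => ?_
    have := h (Fin.castAdd n' i)
    rwa [Fin.append_left] at this
  · refine edgeSubgroupoid_le fun i => ?_
    have := h (Fin.natAdd n i)
    rwa [Fin.append_right] at this

theorem TameSubgroupoid.arrows_subset {L L' : TameSubgroupoid d M} (h : L ≤ L')
    {x y : PathGroupoid d M} : L.1.arrows x y ⊆ L'.1.arrows x y :=
  (Subgroupoid.le_iff _ _).1 h

/-- Every path is trivial or lies in a tame subgroupoid. Trivial paths are an exception because
there are no edges if `d = 0`. -/
theorem eq_id_or_mem_tameSubgroupoid [T2Space M] [IsManifold (𝓡 d) ω M] {x y : PathGroupoid d M}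
    (p : x ⟶ y) :
    (∃ h : x = y, p = eqToHom h) ∨ ∃ L : TameSubgroupoid d M, p ∈ L.1.arrows x y := by
  let Pr : ∀ ⦃x y : PathGroupoid d M⦄, (x ⟶ y) → Prop := fun x y p =>
    (∃ h : x = y, p = eqToHom h) ∨ ∃ L : TameSubgroupoid d M, p ∈ L.1.arrows x y
  have hPr : ∀ ⦃x y z : PathGroupoid d M⦄ (p : x ⟶ y) (q : y ⟶ z), Pr p → Pr q → Pr (p ≫ q) := by
    rintro x y z p q (⟨rfl, rfl⟩ | ⟨L, hL⟩) (⟨rfl, rfl⟩ | ⟨L', hL'⟩)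
    · exact Or.inl ⟨rfl, by simp⟩
    · exact Or.inr ⟨L', by simpa using hL'⟩
    · exact Or.inr ⟨L, by simpa using hL⟩
    · obtain ⟨L'', h, h'⟩ := exists_ge_ge L L'
      exact Or.inr ⟨L'', L''.1.mul (TameSubgroupoid.arrows_subset h hL)
        (TameSubgroupoid.arrows_subset h' hL')⟩
  obtain ⟨c⟩ := p
  change Curve d (M := M) x y at c
  refine Curve.toHom_of_segmentSatisfies (Pr := Pr) c ?_
  refine SegmentSatisfies.of_piecewiseOn hPr c.piecewise ?_
  rintro s t - hst - (h | ⟨(z : M), hz⟩)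
  · refine SegmentSatisfies.of_edge hst h (Or.inr ?_)
    refine ⟨⟨edgeSubgroupoid ![AnalyticCurve.ofArc hst h], 1, _, ?_, rfl⟩, ?_⟩
    · exact fun i j hij => (hij (Subsingleton.elim i j)).elim
    · exact edge_mem ![AnalyticCurve.ofArc hst h] 0
  · refine ⟨c.path.continuous_extend.continuousOn, PiecewiseOn.single hst (Or.inr ⟨z, hz⟩), ?_⟩
    refine (Curve.toHom_of_reparam Pr (c := Curve.refl z) isReparametrization_id
      fun u hu => ?_).1 (Or.inl ⟨rfl, rfl⟩)
    rw [Curve.segment_extend _ _ hu, hz _ ⟨by nlinarith [hu.1], by nlinarith [hu.2]⟩]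
    exact (Path.extend_apply (Path.refl z) hu).symm

end TameSubgroupoids

/-! ### The projections to tame subgroupoids -/

section Projections

open Filter Topology

variable {d : ℕ} {M : Type*} [TopologicalSpace M] [ChartedSpace (EuclideanSpace ℝ (Fin d)) M]
  {G : Type*} [Group G] [TopologicalSpace G]

theorem continuous_restrictTame (L : TameSubgroupoid d M) :
    Continuous (restrictTame (G := G) L) :=
  GroupoidHom.continuous_comap _

theorem continuous_restrictTameOfLE {L L' : TameSubgroupoid d M} (h : L ≤ L') :
    Continuous (restrictTameOfLE (G := G) h) :=
  GroupoidHom.continuous_comap _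

variable [T2Space M] [IsManifold (𝓡 d) ω M]

/-- The projections separate points, as every nontrivial path lies in a tame subgroupoid. -/
theorem eq_of_restrictTame_eq {G : Type*} [Group G] {A B : GeneralizedConnection d M G}
    (h : ∀ L : TameSubgroupoid d M, restrictTame L A = restrictTame L B) : A = B := by
  refine GroupoidHom.evalAll_injective (funext fun ⟨x, y, p⟩ => ?_)
  change A.eval p = B.eval p
  rcases eq_id_or_mem_tameSubgroupoid p with ⟨rfl, rfl⟩ | ⟨L, hL⟩
  · exact (A.eval_id x).trans (B.eval_id x).symm
  · exact congrArg (fun A : ConnectionOn L G => A.eval (x := ⟨x, L.1.mem_objs_of_src hL⟩)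
      (y := ⟨y, L.1.mem_objs_of_tgt hL⟩) ⟨p, hL⟩) (h L)

/-- A closed set of connections on `L` that meets the image of every `𝒜_{L'}`, `L ≤ L'`, meets the
image of `𝒜̄`. -/
theorem exists_restrictTame_mem [T2Space G] [CompactSpace G] [IsTopologicalGroup G]
    (L : TameSubgroupoid d M) {K : Set (ConnectionOn L G)} (hK : IsClosed K)
    (h : ∀ (L' : TameSubgroupoid d M) (h : L ≤ L'), ∃ A, restrictTameOfLE h A ∈ K) :
    ∃ A : GeneralizedConnection d M G, restrictTame L A ∈ K := by
  classical
  choose B hB using h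
  let g : TameSubgroupoid d M → (Σ x y : PathGroupoid d M, x ⟶ y) → G := fun L' =>
    if h : L ≤ L' then extendByOne L'.1 (B L' h) else 1
  let u : Ultrafilter (TameSubgroupoid d M) := Ultrafilter.of atTop
  have hu : ∀ L', ∀ᶠ L'' in (u : Filter (TameSubgroupoid d M)), L' ≤ L'' :=
    fun L' => Ultrafilter.of_le _ (eventually_ge_atTop L')
  obtain ⟨a, -, ha⟩ := isCompact_univ.ultrafilter_le_nhds (u.map g) (by simp)
  replace ha : ∀ z, Tendsto (fun L' => g L' z) u (𝓝 (a z)) := tendsto_pi_nhds.1 ha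
  have hg1 : ∀ L' x, g L' ⟨x, x, 𝟙 x⟩ = 1 := by
    intro L' x
    by_cases h : L ≤ L'
    · simp only [g, dif_pos h]
      exact extendByOne_id _ x
    · simp only [g, dif_neg h]
      rfl
  have hmul : ∀ (x y z : PathGroupoid d M) (p : x ⟶ y) (q : y ⟶ z),
      a ⟨x, z, p ≫ q⟩ = a ⟨y, z, q⟩ * a ⟨x, y, p⟩ := by
    intro x y z p q
    refine tendsto_nhds_unique_of_eventuallyEq (ha ⟨x, z, p ≫ q⟩)
      ((ha ⟨y, z, q⟩).mul (ha ⟨x, y, p⟩)) ?_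
    rcases eq_id_or_mem_tameSubgroupoid p with ⟨rfl, rfl⟩ | ⟨L₁, h₁⟩
    · simp [hg1]
    rcases eq_id_or_mem_tameSubgroupoid q with ⟨rfl, rfl⟩ | ⟨L₂, h₂⟩
    · simp [hg1]
    filter_upwards [hu L, hu L₁, hu L₂] with L' hL hL₁ hL₂
    simp only [g, dif_pos hL]
    exact extendByOne_comp _ (TameSubgroupoid.arrows_subset hL₁ h₁)
      (TameSubgroupoid.arrows_subset hL₂ h₂)
  refine ⟨GroupoidHom.ofEval a hmul, ?_⟩
  let b : TameSubgroupoid d M → ConnectionOn L G := fun L' =>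
    if h : L ≤ L' then restrictTameOfLE h (B L' h) else restrictTame L (GroupoidHom.ofEval a hmul)
  have hb : Tendsto b u (𝓝 (restrictTame L (GroupoidHom.ofEval a hmul))) := by
    rw [GroupoidHom.isInducing_evalAll.tendsto_nhds_iff, tendsto_pi_nhds]
    rintro ⟨x, y, p⟩
    refine (ha ⟨x.1, y.1, p.1⟩).congr' ?_
    filter_upwards [hu L] with L' hL
    simp only [g, b, dif_pos hL, Function.comp_apply]
    exact extendByOne_of_mem _ (TameSubgroupoid.arrows_subset hL p.2)
  refine hK.mem_of_tendsto hb ?_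
  filter_upwards [hu L] with L' hL
  simp only [b, dif_pos hL]
  exact hB L' hL

end Projections

/-! ### The bijection -/

theorem proposition3p3 (d k : ℕ)
    (M : Type*) [TopologicalSpace M] [ChartedSpace (EuclideanSpace ℝ (Fin d)) M]
    [IsManifold (𝓡 d) ω M] [T2Space M] [ParacompactSpace M] [ConnectedSpace M]
    (G : Type*) [Group G] [TopologicalSpace G] [ChartedSpace (EuclideanSpace ℝ (Fin k)) G]
    [LieGroup (𝓡 k) ∞ G] [T2Space G] [CompactSpace G] [ConnectedSpace G] :
    ∃ Φ : RegularProbability (GeneralizedConnection d M G) ≃ ConsistentFamily d M G,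
      (∀ (μ : RegularProbability (GeneralizedConnection d M G)) (L : TameSubgroupoid d M),
        ((Φ μ).1 L).1 = μ.1.map (restrictTame L)) ∧
      ∀ ν : ConsistentFamily d M G, ∃! μ : RegularProbability (GeneralizedConnection d M G),
        ∀ (L : TameSubgroupoid d M) (f : C(ConnectionOn L G, ℂ)),
          ∫ A, f A ∂(ν.1 L).1 = ∫ A, f (restrictTame L A) ∂μ.1 := by
  have : IsTopologicalGroup G := topologicalGroup_of_lieGroup (𝓡 k) ∞
  let p : ∀ L : TameSubgroupoid d M, C(GeneralizedConnection d M G, ConnectionOn L G) := fun L =>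
    ⟨restrictTame L, continuous_restrictTame L⟩
  let q : ∀ L L' : TameSubgroupoid d M, L ≤ L' → C(ConnectionOn L' G, ConnectionOn L G) :=
    fun _ _ h => ⟨restrictTameOfLE h, continuous_restrictTameOfLE h⟩
  have hqp : ∀ L L' h, (q L L' h).comp (p L') = p L := fun _ _ _ => rfl
  have hreg : ∀ (μ : RegularProbability (GeneralizedConnection d M G)) (L : TameSubgroupoid d M),
      IsProbabilityMeasure (μ.1.map (restrictTame L)) ∧ (μ.1.map (restrictTame L)).Regular := by
    intro μ L
    have := μ.2.1
    have := μ.2.2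
    exact ⟨Measure.isProbabilityMeasure_map (continuous_restrictTame L).aemeasurable,
      regular_map_of_continuous (continuous_restrictTame L)⟩
  let Ψ : RegularProbability (GeneralizedConnection d M G) → ConsistentFamily d M G := fun μ =>
    ⟨fun L => ⟨μ.1.map (restrictTame L), hreg μ L⟩, fun L L' h =>
      (Measure.map_map (continuous_restrictTameOfLE h).measurable
        (continuous_restrictTame L').measurable).symm⟩
  have hinj : Function.Injective Ψ := by
    intro μ μ' h
    have := μ.2.1
    have := μ.2.2
    have := μ'.2.1
    have := μ'.2.2
    refine Subtype.ext (measure_ext_of_map_eq p q hqp (fun _ _ => eq_of_restrictTame_eq) fun L => ?_)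
    exact congrArg (fun ν : ConsistentFamily d M G => (ν.1 L).1) h
  have hsurj : Function.Surjective Ψ := by
    intro ν
    have := fun L => (ν.1 L).2.1
    have := fun L => (ν.1 L).2.2
    obtain ⟨μ, hμ, hμr, h⟩ := exists_measure_of_consistent p q hqp
      (fun L K hK h => exists_restrictTame_mem L hK h) (fun L => (ν.1 L).1) ν.2
    exact ⟨⟨μ, hμ, hμr⟩, Subtype.ext (funext fun L => Subtype.ext (h L))⟩
  refine ⟨Equiv.ofBijective Ψ ⟨hinj, hsurj⟩, fun _ _ => rfl, fun ν => ?_⟩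
  have hint : ∀ (μ : RegularProbability (GeneralizedConnection d M G)) (L : TameSubgroupoid d M)
      (f : C(ConnectionOn L G, ℂ)),
      ∫ A, f A ∂((Ψ μ).1 L).1 = ∫ A, f (restrictTame L A) ∂μ.1 := fun μ L f =>
    integral_map (continuous_restrictTame L).aemeasurable
      f.continuous.measurable.aestronglyMeasurable
  obtain ⟨μ, rfl⟩ := hsurj ν
  refine ⟨μ, hint μ, fun μ' hμ' => hinj (Subtype.ext (funext fun L => Subtype.ext ?_))⟩
  have := ((Ψ μ).1 L).2.1
  have := ((Ψ μ).1 L).2.2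
  have := ((Ψ μ').1 L).2.1
  have := ((Ψ μ').1 L).2.2
  refine measure_ext_of_integral_continuousMap fun f => ?_
  have h := (hint μ' L ((ContinuousMap.mk _ Complex.continuous_ofReal).comp f)).trans
    (hμ' L ((ContinuousMap.mk _ Complex.continuous_ofReal).comp f)).symm
  simp only [ContinuousMap.comp_apply, ContinuousMap.coe_mk] at h
  rw [integral_complex_ofReal, integral_complex_ofReal] at h
  exact_mod_cast h
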